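/- A 2PFA verifier is a two-way probabilistic finite automaton, with arbitrary real transition probabilities, reading an input word $w$ between two end-markers and exchanging symbols of a finite alphabet with a prover. When in a communicating state, the verifier sends the symbol attached to the state and moves to a state determined by the prover's reply. The prover sees only $w$ and the symbols sent by the verifier (not its coin tosses) and is otherwise unrestricted. The verifier verifies a language $L$ with bounded error if, for some $\varepsilon<\frac12$, there is a prover with which every $w\in L$ is accepted with probability at least $1-\varepsilon$, and every $w\notin L$ is rejected with probability at least $1-\varepsilon$ whatever the prover. It runs in quadratic expected time if, on every input of length $n$ and with every prover, its expected number of steps is $O(n^2)$ (that is, at most $K(n^2+1)$ for a constant $K$ depending only on the verifier). For every set $I$ of positive integers, the unary language $$\mathtt{UPOWER64}(I)=\{a^{64^k}\mid k\in I\}$$ is verified with bounded error by a 2PFA verifier in quadratic expected time. Consequently, 2PFA verifiers can verify uncountably many unary languages with bounded error in quadratic expected time. -/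

import Mathlib

open scoped ENNReal

/-- Contents of the cells of the input tape `¢ w $`: the two end-markers and the input symbols. -/
inductive TapeSymbol (A : Type) : Type
  | leftEnd : TapeSymbol A
  | letter (a : A) : TapeSymbol A
  | rightEnd : TapeSymbol A

/-- The moves of the input head. -/
inductive HeadMove : Type
  | left : HeadMove
  | stay : HeadMove
  | right : HeadMove

/-- The states of a verifier with reading states `R` and communicating states `C`; there are two
halting states, the accepting one and the rejecting one. -/
inductive VerifierState (R C : Type) : Type
  | reading (s : R) : VerifierState R C
  | communicating (s : C) : VerifierState R C
  | accept : VerifierState R C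
  | reject : VerifierState R C

/-- A private-coin two-way probabilistic finite automaton verifier over the input alphabet `A`.
Transition probabilities are arbitrary real numbers. -/
structure TwoPFAVerifier (A : Type) where
  /-- the reading states -/
  R : Type
  /-- the communicating states -/
  C : Type
  /-- the communication alphabet -/
  U : Type
  finite_R : Finite R
  finite_C : Finite C
  finite_U : Finite U
  nonempty_U : Nonempty U
  /-- the initial state, which is a reading state -/
  start : R
  /-- `readStep s x` is the probability distribution of the next state and the head move, when the
  symbol `x` is read in the reading state `s` -/
  readStep : R → TapeSymbol A → PMF (VerifierState R C × HeadMove)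
  /-- the symbol that is written on the communication cell in a communicating state -/
  message : C → U
  /-- the next state, given the symbol with which the prover replies -/
  commStep : C → U → VerifierState R C

/-- The symbol in cell `i` of the tape `¢ w $`, whose cells are `0, …, |w| + 1`. -/
def tapeSymbolAt {A : Type} (w : List A) : ℕ → TapeSymbol A
  | 0 => TapeSymbol.leftEnd
  | i + 1 => (w[i]?).elim TapeSymbol.rightEnd TapeSymbol.letter

/-- The head position after a move. The head never leaves the tape `¢ w $`: a move beyond an
end-marker leaves it where it is. -/
def moveHead {A : Type} (w : List A) (i : ℕ) : HeadMove → ℕ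
  | HeadMove.left => i - 1
  | HeadMove.stay => i
  | HeadMove.right => min (i + 1) (w.length + 1)

namespace TwoPFAVerifier

variable {A : Type}

/-- A prover sees the input and the symbols that the verifier has written on the communication
cell so far (the oldest first, the current one last), and nothing else; it replies with a symbol.
There is no restriction on its computational power. -/
def Prover (V : TwoPFAVerifier A) : Type := List A → List V.U → V.U

/-- A configuration: state, head position, and the symbols sent so far by the verifier. -/
structure Config (V : TwoPFAVerifier A) : Type where
  state : VerifierState V.R V.C
  head : ℕ
  sent : List V.U

/-- The initial configuration, with the head on the left end-marker. -/
def init (V : TwoPFAVerifier A) : V.Config := ⟨VerifierState.reading V.start, 0, []⟩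

/-- One step on the input `w` with the prover `P`. Halting configurations do not change. -/
noncomputable def step (V : TwoPFAVerifier A) (P : V.Prover) (w : List A) :
    V.Config → PMF V.Config
  | ⟨VerifierState.reading s, i, h⟩ =>
      (V.readStep s (tapeSymbolAt w i)).map fun r => ⟨r.1, moveHead w i r.2, h⟩
  | ⟨VerifierState.communicating s, i, h⟩ =>
      PMF.pure ⟨V.commStep s (P w (h ++ [V.message s])), i, h ++ [V.message s]⟩
  | ⟨VerifierState.accept, i, h⟩ => PMF.pure ⟨VerifierState.accept, i, h⟩
  | ⟨VerifierState.reject, i, h⟩ => PMF.pure ⟨VerifierState.reject, i, h⟩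

/-- The distribution of the configuration after `t` steps. -/
noncomputable def run (V : TwoPFAVerifier A) (P : V.Prover) (w : List A) : ℕ → PMF V.Config
  | 0 => PMF.pure V.init
  | t + 1 => (run V P w t).bind (V.step P w)

/-- The probability that `V`, communicating with `P`, accepts `w`: the supremum (which is the
limit) over `t` of the probability of having accepted within `t` steps. -/
noncomputable def acceptProb (V : TwoPFAVerifier A) (P : V.Prover) (w : List A) : ℝ≥0∞ :=
  ⨆ t : ℕ, (V.run P w t).toOuterMeasure {c | c.state = VerifierState.accept}

/-- The probability that `V`, communicating with `P`, rejects `w`. -/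
noncomputable def rejectProb (V : TwoPFAVerifier A) (P : V.Prover) (w : List A) : ℝ≥0∞ :=
  ⨆ t : ℕ, (V.run P w t).toOuterMeasure {c | c.state = VerifierState.reject}

/-- The expected number of steps that are carried out until the computation halts: the sum over
`t` of the probability that the computation has not halted after `t` steps. -/
noncomputable def expectedTime (V : TwoPFAVerifier A) (P : V.Prover) (w : List A) : ℝ≥0∞ :=
  ∑' t : ℕ, (V.run P w t).toOuterMeasure
    {c | c.state ≠ VerifierState.accept ∧ c.state ≠ VerifierState.reject}

/-- `V` verifies the language `L` with error bound `ε`: completeness and soundness. -/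
def Verifies (V : TwoPFAVerifier A) (L : Language A) (ε : ℝ≥0∞) : Prop :=
  (∃ P : V.Prover, ∀ w ∈ L, 1 - ε ≤ V.acceptProb P w) ∧
  (∀ w ∉ L, ∀ P : V.Prover, 1 - ε ≤ V.rejectProb P w)

/-- The expected running time is quadratic in the input length, on every input and with every
prover. -/
def QuadraticExpectedTime (V : TwoPFAVerifier A) : Prop :=
  ∃ K : ℕ, ∀ (w : List A) (P : V.Prover),
    V.expectedTime P w ≤ ((K * (w.length ^ 2 + 1) : ℕ) : ℝ≥0∞)

end TwoPFAVerifier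

/-- `L` is verified by a 2PFA with bounded error in quadratic expected time. -/
def VerifiableInQuadraticTime {A : Type} (L : Language A) : Prop :=
  ∃ V : TwoPFAVerifier A,
    (∃ ε : ℝ≥0∞, ε < 1 / 2 ∧ V.Verifies L ε) ∧ V.QuadraticExpectedTime

/-- The unary word `a ^ (64 ^ k)`. As `64 ^ k` increases strictly with `k`, it is, for `k > 0`, the
`k`-th shortest member of `{a ^ (64 ^ m) | m > 0}`. -/
def upower64Word (k : ℕ+) : List Unit := List.replicate (64 ^ (k : ℕ)) ()

/-- The language `UPOWER64(I)` of the words `a ^ (64 ^ k)` with `k ∈ I`. -/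
def UPOWER64 (I : Set ℕ+) : Language Unit := {w | ∃ k ∈ I, w = upower64Word k}

/-!
The verifier's messages carry no information, so a prover amounts to a certificate fixed in advance.
On an input of length `n`, the correct certificate carries marks of period `n` and marks of period
`n + 1`, which first coincide at position `n * (n + 1)`, and a chain of blocks of lengths
`n, n / 64, …, 1`, which exists exactly when `n` is a power of `64`. The verifier privately picks
one property of the certificate to check, by cycles of head movements; as the prover does not learn
the choice, it must satisfy every check at once.

If all marks are correct and `n = 64 ^ k`, they delimit `n * (n + 1)` tosses of a coin with bias
`θ = ∑ k, d k / 64 ^ k`. The number of heads divided by `n + 1` is close to `64 ^ k * θ`, whose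
residue modulo `64` is close to `d k`. The standard deviation is less than `n + 1`, so the digits
`d k = 48` for `k ∈ I` and `d k = 16` otherwise are told apart by Chebyshev's inequality.

Between two cycles the verifier gives up with probability `1 / (64 * (n + 1))`, rejecting. A cycle
takes `O(n)` steps, so the expected time is quadratic and a prover gains nothing by keeping a check
going forever, while the correct certificate, which needs at most `n + 1` cycles, loses at most
`1 / 64`.
-/

section Expectation

variable {α β : Type*}

/-- The expectation of an extended nonnegative function with respect to a probability mass
function. -/
noncomputable def expectation (q : PMF α) (f : α → ℝ≥0∞) : ℝ≥0∞ := ∑' a, q a * f a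

lemma expectation_pure (a : α) (f : α → ℝ≥0∞) : expectation (PMF.pure a) f = f a := by
  rw [expectation, tsum_eq_single a fun b hb => by simp [PMF.pure_apply, hb]]
  simp

lemma expectation_bind (q : PMF α) (g : α → PMF β) (f : β → ℝ≥0∞) :
    expectation (q.bind g) f = expectation q fun a => expectation (g a) f := by
  simp only [expectation, PMF.bind_apply, ← ENNReal.tsum_mul_right, ← ENNReal.tsum_mul_left]
  rw [ENNReal.tsum_comm]
  simp only [mul_assoc]

lemma expectation_map (q : PMF α) (g : α → β) (f : β → ℝ≥0∞) :
    expectation (q.map g) f = expectation q (f ∘ g) := by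
  simp [← PMF.bind_pure_comp, expectation_bind, expectation_pure, Function.comp_def]

lemma toOuterMeasure_eq_expectation (q : PMF α) (s : Set α) :
    q.toOuterMeasure s = expectation q (s.indicator 1) := by
  rw [PMF.toOuterMeasure_apply, expectation]
  refine tsum_congr fun a => ?_
  by_cases h : a ∈ s <;> simp [h]

lemma expectation_mono (q : PMF α) : Monotone (expectation q) :=
  fun _ _ h => ENNReal.tsum_le_tsum fun a => by gcongr; exact h a

lemma expectation_const (q : PMF α) (r : ℝ≥0∞) : expectation q (fun _ => r) = r := by
  rw [expectation, ENNReal.tsum_mul_right, q.tsum_coe, one_mul]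

lemma expectation_add (q : PMF α) (f g : α → ℝ≥0∞) :
    expectation q (f + g) = expectation q f + expectation q g := by
  simp only [expectation, Pi.add_apply, mul_add, ENNReal.tsum_add]

lemma expectation_iSup (q : PMF α) {f : ℕ → α → ℝ≥0∞} (hf : Monotone f) :
    expectation q (fun a => ⨆ t, f t a) = ⨆ t, expectation q (f t) := by
  simp only [expectation, ENNReal.tsum_eq_iSup_sum, ENNReal.mul_iSup]
  rw [iSup_comm]
  exact iSup_congr fun s => ENNReal.finsetSum_iSup_of_monotone fun a t t' h => by
    gcongr; exact hf h a

/-- A coin that shows `true` with probability `p`. -/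
noncomputable def coin (p : unitInterval) : PMF Bool :=
  PMF.ofFintype (fun b => ENNReal.ofReal (if b then p else 1 - p)) (by
    simp [← ENNReal.ofReal_add p.2.1 (sub_nonneg.2 p.2.2)])

lemma expectation_coin (p : unitInterval) (f : Bool → ℝ≥0∞) :
    expectation (coin p) f = ENNReal.ofReal p * f true + ENNReal.ofReal (1 - p) * f false := by
  simp [expectation, coin, tsum_fintype]

end Expectation

namespace TwoPFAVerifier

variable {A : Type} (V : TwoPFAVerifier A) (P : V.Prover) (w : List A)

/-- The one-step operator of the Markov chain: the expectation of a function of the configuration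
after one step. -/
noncomputable def next (f : V.Config → ℝ≥0∞) (c : V.Config) : ℝ≥0∞ :=
  expectation (V.step P w c) f

lemma expectation_run (f : V.Config → ℝ≥0∞) (t : ℕ) :
    expectation (V.run P w t) f = (V.next P w)^[t] f V.init := by
  induction t generalizing f with
  | zero => simp [run, expectation_pure]
  | succ t ih => rw [run, expectation_bind, Function.iterate_succ_apply, ← ih]; rfl

lemma next_mono : Monotone (V.next P w) := fun _ _ h c => expectation_mono (V.step P w c) h

lemma next_add (f g : V.Config → ℝ≥0∞) :
    V.next P w (f + g) = V.next P w f + V.next P w g :=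
  funext fun c => expectation_add (V.step P w c) f g

lemma next_sum (s : Finset ℕ) (f : ℕ → V.Config → ℝ≥0∞) :
    V.next P w (∑ i ∈ s, f i) = ∑ i ∈ s, V.next P w (f i) := by
  let nextHom : (V.Config → ℝ≥0∞) →+ (V.Config → ℝ≥0∞) :=
    { toFun := V.next P w
      map_zero' := funext fun c => expectation_const (V.step P w c) 0
      map_add' := V.next_add P w }
  exact map_sum nextHom f s

lemma iterate_next_one (t : ℕ) : (V.next P w)^[t] 1 = 1 :=
  Function.iterate_fixed (funext fun c => expectation_const (V.step P w c) 1) t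

lemma iterate_next_add (f g : V.Config → ℝ≥0∞) (t : ℕ) :
    (V.next P w)^[t] (f + g) = (V.next P w)^[t] f + (V.next P w)^[t] g := by
  induction t generalizing f g with
  | zero => rfl
  | succ t ih => simp only [Function.iterate_succ_apply, next_add, ih]

/-- The accepting and the rejecting state. -/
def IsHalting {V : TwoPFAVerifier A} (q : VerifierState V.R V.C) : Prop :=
  q = .accept ∨ q = .reject

lemma next_of_isHalting {V : TwoPFAVerifier A} (P : V.Prover) (w : List A) {c : V.Config}
    (hc : IsHalting c.state) (f : V.Config → ℝ≥0∞) : V.next P w f c = f c := by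
  obtain ⟨q, i, h⟩ := c
  rcases hc with rfl | rfl <;> simp [next, step, expectation_pure]

/-- The indicator of the configurations in state `q`. -/
noncomputable def inState (q : VerifierState V.R V.C) : V.Config → ℝ≥0∞ :=
  Set.indicator {c | c.state = q} 1

/-- The probability of ever being in the halting state `q` when the computation starts from a given
configuration. -/
noncomputable def haltProb (q : VerifierState V.R V.C) (c : V.Config) : ℝ≥0∞ :=
  ⨆ t : ℕ, (V.next P w)^[t] (V.inState q) c

lemma acceptProb_eq_haltProb : V.acceptProb P w = V.haltProb P w .accept V.init := by
  simp only [acceptProb, haltProb, toOuterMeasure_eq_expectation, expectation_run]; rfl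

lemma rejectProb_eq_haltProb : V.rejectProb P w = V.haltProb P w .reject V.init := by
  simp only [rejectProb, haltProb, toOuterMeasure_eq_expectation, expectation_run]; rfl

lemma haltProb_le_one (q : VerifierState V.R V.C) (c : V.Config) : V.haltProb P w q c ≤ 1 := by
  have hle : V.inState q ≤ 1 := Set.indicator_le_self' fun _ _ => zero_le
  refine iSup_le fun t => ?_
  exact ((V.next_mono P w).iterate t hle c).trans_eq (congrFun (V.iterate_next_one P w t) c)

variable {V} in
lemma haltProb_of_isHalting (q : VerifierState V.R V.C) {c : V.Config}
    (hc : IsHalting c.state) : V.haltProb P w q c = V.inState q c := by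
  have hconst (t : ℕ) : (V.next P w)^[t] (V.inState q) c = V.inState q c := by
    induction t with
    | zero => rfl
    | succ t ih => rw [Function.iterate_succ_apply', next_of_isHalting P w hc, ih]
  simp [haltProb, hconst]

variable {V} in
lemma monotone_iterate_inState {q : VerifierState V.R V.C} (hq : IsHalting q) :
    Monotone fun t => (V.next P w)^[t] (V.inState q) := by
  refine (V.next_mono P w).monotone_iterate_of_le_map fun c => ?_
  by_cases hc : c.state = q
  · rw [next_of_isHalting P w (hc ▸ hq)]
  · simp [inState, hc]

variable {V} in
lemma next_haltProb {q : VerifierState V.R V.C} (hq : IsHalting q) (c : V.Config) :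
    V.next P w (V.haltProb P w q) c = V.haltProb P w q c := by
  have hmono := monotone_iterate_inState P w hq
  calc V.next P w (V.haltProb P w q) c
      = ⨆ t : ℕ, (V.next P w)^[t + 1] (V.inState q) c := by
        simp only [Function.iterate_succ_apply']
        exact expectation_iSup (V.step P w c) hmono
    _ = V.haltProb P w q c := (hmono.apply₂ c).iSup_nat_add 1

/-- The indicator of the configurations in which the verifier has not halted. -/
noncomputable def running : V.Config → ℝ≥0∞ := Set.indicator {c | ¬IsHalting c.state} 1

lemma expectedTime_eq_tsum : V.expectedTime P w = ∑' t, (V.next P w)^[t] V.running V.init := by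
  simp only [expectedTime, toOuterMeasure_eq_expectation, expectation_run, running, IsHalting,
    not_or]

/-- A function that drops in expectation by at least `1` with every step bounds the expected time:
by induction it bounds the expected number of steps among the first `t`. -/
lemma expectedTime_le_of_drift {T : V.Config → ℝ≥0∞}
    (hT : ∀ c, ¬IsHalting c.state → 1 + V.next P w T c ≤ T c) :
    V.expectedTime P w ≤ T V.init := by
  have hpartial (t : ℕ) : ∑ s ∈ Finset.range t, (V.next P w)^[s] V.running ≤ T := by
    induction t with
    | zero => simp
    | succ t ih =>
      intro c
      have hstep : (∑ s ∈ Finset.range (t + 1), (V.next P w)^[s] V.running) c ≤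
          V.next P w T c + V.running c := by
        rw [Finset.sum_range_succ']
        simp only [Function.iterate_succ_apply', ← next_sum, Function.iterate_zero_apply,
          Pi.add_apply]
        gcongr
        exact V.next_mono P w ih c
      refine hstep.trans ?_
      by_cases hc : IsHalting c.state
      · simp [running, hc, next_of_isHalting P w hc]
      · simpa [running, hc, add_comm] using hT c hc
  rw [expectedTime_eq_tsum]
  exact ENNReal.tsum_le_of_sum_range_le fun t => by simpa using hpartial t V.init

lemma acceptProb_add_rejectProb (h : V.expectedTime P w ≠ ∞) :
    V.acceptProb P w + V.rejectProb P w = 1 := by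
  have hsum (t : ℕ) : (V.next P w)^[t] (V.inState .accept) V.init +
      (V.next P w)^[t] (V.inState .reject) V.init + (V.next P w)^[t] V.running V.init = 1 := by
    have hone : V.inState .accept + V.inState .reject + V.running = 1 := by
      ext ⟨q, i, h⟩
      cases q <;> simp [inState, running, IsHalting]
    simp only [← Pi.add_apply, ← iterate_next_add, hone, iterate_next_one, Pi.one_apply]
  have hlim {q : VerifierState V.R V.C} (hq : IsHalting q) := tendsto_atTop_iSup
    ((monotone_iterate_inState P w hq).apply₂ V.init)
  have hrunning := ENNReal.tendsto_atTop_zero_of_tsum_ne_top (V.expectedTime_eq_tsum P w ▸ h)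
  have htotal := ((hlim (.inl rfl)).add (hlim (.inr rfl))).add hrunning
  rw [add_zero] at htotal
  rw [acceptProb_eq_haltProb, rejectProb_eq_haltProb]
  refine tendsto_nhds_unique htotal ?_
  simp only [hsum, tendsto_const_nhds]

end TwoPFAVerifier

lemma tapeSymbolAt_letter {w : List Unit} {h : ℕ} (hw : h < w.length) :
    tapeSymbolAt w (h + 1) = .letter () := by
  simp [tapeSymbolAt, hw]

lemma tapeSymbolAt_rightEnd {A : Type} {w : List A} {h : ℕ} (hw : w.length < h) :
    tapeSymbolAt w h = .rightEnd := by
  obtain ⟨i, rfl⟩ := Nat.exists_eq_succ_of_ne_zero (Nat.ne_zero_of_lt hw)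
  simp [tapeSymbolAt, Nat.le_of_lt_succ hw]

lemma tapeSymbolAt_ne_rightEnd {A : Type} {w : List A} {h : ℕ} (hw : h ≤ w.length) :
    tapeSymbolAt w h ≠ .rightEnd := by
  cases h with
  | zero => simp [tapeSymbolAt]
  | succ h => simp [tapeSymbolAt, Nat.lt_of_succ_le hw]

lemma tapeSymbolAt_ne_leftEnd {A : Type} (w : List A) (h : ℕ) :
    tapeSymbolAt w (h + 1) ≠ .leftEnd := by
  rcases lt_or_ge h w.length with hw | hw <;> simp [tapeSymbolAt, hw]

lemma moveHead_right {A : Type} {w : List A} {h : ℕ} (hw : h ≤ w.length) :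
    moveHead w h .right = h + 1 := by
  simp [moveHead, hw]

namespace PowerVerifier

/-- The symbols of the certificate that the prover presents. The track `mark d` should have the
period `n`, for `d = false`, or `n + 1`, for `d = true`, where `n` is the input length; the track
`chain` marks the ends of consecutive blocks, each of which should be `64` times as long as the
next one. -/
structure CertSymbol where
  mark : Bool → Bool
  chain : Bool
  deriving Fintype, Inhabited

/-- Both period marks are present. A correct certificate has the first such symbol at position
`n * (n + 1)`. -/
def CertSymbol.both (u : CertSymbol) : Bool := u.mark false && u.mark true

/-- What the verifier checks: one of the two periods; that the first block of the chain has the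
length of the input; that a block is `64` times as long as the next one (`up` while reading the
longer block, `down` while reading the shorter one); the number of heads among the coin tosses up
to the first coincidence of the period marks. The parameter of `up` is the number of symbols of the
block read at the current head position, that of `cnt` is the number of heads divided by `n + 1`;
both are kept modulo `64`. -/
inductive Mode
  | lap (d : Bool)
  | whole
  | up (j : ZMod 64)
  | down
  | cnt (s : ZMod 64)
  deriving Fintype

/-- The reading states of the verifier: `look` checks that the input has at least two letters,
`pick` chooses the mode, `ret` returns to the left end-marker between two cycles, `walk` is a
random walk that gives up at the right end-marker, `act` and `check` process a certificate symbol
by moving the head and by comparing its new position with the symbol. -/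
inductive Control
  | look (i : Fin 3)
  | pick (i : Fin 5)
  | ret (m : Mode)
  | walk (m : Mode)
  | act (m : Mode) (u : CertSymbol)
  | check (m : Mode) (u : CertSymbol)
  deriving Fintype

/-- The states of the verifier. -/
abbrev State := VerifierState Control Mode

/-- The mode that is chosen in the state `pick i`. -/
def startMode : Fin 5 → Mode
  | 0 => .lap false
  | 1 => .lap true
  | 2 => .whole
  | 3 => .up 0
  | 4 => .cnt 0

/-- The head move at the beginning of a cycle. -/
def entryMove : Mode → HeadMove
  | .lap false => .right
  | .whole => .right
  | _ => .stay

/-- The position at which the first certificate symbol of a cycle is read. -/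
def entryPos : Mode → ℕ
  | .lap false => 1
  | .whole => 1
  | _ => 0

/-- The reaction to the certificate symbol `u`, given the scanned symbol and the outcome of a coin
toss. A block may end in mode `up j` only after `64 * h` symbols, in the state `j = 63` at head
position `h - 1`, or as the last block, of length `1`. -/
def react (m : Mode) (u : CertSymbol) (x : TapeSymbol Unit) (b : Bool) : State × HeadMove :=
  match x, m with
  | .rightEnd, _ => (.reject, .stay)
  | _, .lap d => (.reading (.check (.lap d) u), .right)
  | _, .whole => (.reading (.check .whole u), .right)
  | x, .up j =>
    if u.chain then
      if j = 63 then (.communicating .down, .right)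
      else match x with
        | .leftEnd => if j = 0 then (.accept, .stay) else (.reject, .stay)
        | _ => (.reject, .stay)
    else (.communicating (.up (j + 1)), if j = 63 then .right else .stay)
  | .leftEnd, .down => (.reject, .stay)
  | _, .down => (.reading (.check .down u), .left)
  | _, .cnt s => (.reading (.check (.cnt s) u), if b then .right else .stay)

/-- The verdict on the number of heads, given the number of completed passes modulo `64`. -/
def decision (s : ZMod 64) : State := if 32 ≤ s.val then .accept else .reject

/-- The comparison of the certificate symbol `u` with the scanned symbol. -/
def verdict (u : CertSymbol) : Mode → TapeSymbol Unit → State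
  | .lap d, .rightEnd =>
    if u.mark d then (if u.both then .accept else .reading (.ret (.lap d))) else .reject
  | .lap d, _ => if u.mark d then .reject else .communicating (.lap d)
  | .whole, .rightEnd => if u.chain then .reading (.ret (.up 0)) else .reject
  | .whole, _ => if u.chain then .reject else .communicating .whole
  | .up _, _ => .reject
  | .down, .leftEnd => if u.chain then .reading (.ret (.up 0)) else .reject
  | .down, _ => if u.chain then .reject else .communicating .down
  | .cnt s, .rightEnd => if u.both then decision (s + 1) else .reading (.ret (.cnt (s + 1)))
  | .cnt s, _ => if u.both then decision s else .communicating (.cnt s)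

/-- The next state and the head move, given the scanned symbol and the outcome of a coin toss. -/
def outcome : Control → TapeSymbol Unit → Bool → State × HeadMove
  | .look 0, _, _ => (.reading (.look 1), .right)
  | .look 1, .letter _, _ => (.reading (.look 2), .right)
  | .look 2, .letter _, _ => (.reading (.pick 0), .stay)
  | .look _, _, _ => (.reject, .stay)
  | .pick i, _, true => (.reading (.ret (startMode i)), .stay)
  | .pick i, _, false => (if i = 4 then .reject else .reading (.pick (i + 1)), .stay)
  | .ret m, .leftEnd, true => (.reading (.walk m), .right)
  | .ret m, .leftEnd, false => (.communicating m, entryMove m)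
  | .ret m, _, _ => (.reading (.ret m), .left)
  | .walk m, .leftEnd, _ => (.communicating m, entryMove m)
  | .walk m, .letter _, b => (.reading (.walk m), if b then .right else .left)
  | .walk _, .rightEnd, _ => (.reject, .stay)
  | .act m u, x, b => react m u x b
  | .check m u, x, _ => (verdict u m x, .stay)

/-- The bias of the coin that is tossed in a reading state. In the states `pick i` it is chosen so
that every mode is picked with probability `1 / 9`; the verifier rejects outright with probability
`4 / 9`. -/
noncomputable def bias (θ : unitInterval) : Control → unitInterval
  | .pick i => ⟨1 / (9 - (i : ℕ)), by
      have h : ((i : ℕ) : ℝ) ≤ 4 := by exact_mod_cast Nat.le_of_lt_succ i.2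
      exact ⟨div_nonneg zero_le_one (by linarith),
        div_le_one_of_le₀ (by linarith) (by linarith)⟩⟩
  | .ret _ => ⟨1 / 64, by norm_num, by norm_num⟩
  | .walk _ => ⟨1 / 2, by norm_num, by norm_num⟩
  | _ => θ

/-- The verifier for `UPOWER64`, whose counting coin has the bias `θ`. Its messages carry no
information, so the replies of a prover form a certificate that is fixed in advance. -/
noncomputable abbrev verifier (θ : unitInterval) : TwoPFAVerifier Unit where
  R := Control
  C := Mode
  U := CertSymbol
  finite_R := inferInstance
  finite_C := inferInstance
  finite_U := inferInstance
  nonempty_U := inferInstance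
  start := .look 0
  readStep s x := (coin (bias θ s)).map (outcome s x)
  message _ := default
  commStep m u := .reading (.act m u)

/-- The state and the head position that follow a reading state, given the outcome of the coin
toss. -/
def target (w : List Unit) (s : Control) (h : ℕ) (b : Bool) : State × ℕ :=
  ((outcome s (tapeSymbolAt w h) b).1, moveHead w h (outcome s (tapeSymbolAt w h) b).2)

section target

variable {w : List Unit} {m : Mode} {u : CertSymbol} {h : ℕ} (b : Bool)

lemma moveHead_entryMove (w : List Unit) (m : Mode) :
    moveHead w 0 (entryMove m) = entryPos m := by
  rcases m with (_ | _) | _ | _ | _ | _ <;> simp [moveHead, entryMove, entryPos]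

lemma target_ret_zero :
    target w (.ret m) 0 b =
      if b then (.reading (.walk m), 1) else (.communicating m, entryPos m) := by
  cases b <;> simp [target, tapeSymbolAt, outcome, moveHead_right, moveHead_entryMove]

lemma target_ret_succ : target w (.ret m) (h + 1) b = (.reading (.ret m), h) := by
  rcases hx : tapeSymbolAt w (h + 1) with _ | _ | _
  · exact absurd hx (tapeSymbolAt_ne_leftEnd w h)
  all_goals simp [target, hx, outcome, moveHead]

lemma target_walk_zero : target w (.walk m) 0 b = (.communicating m, entryPos m) := by
  simp [target, tapeSymbolAt, outcome, moveHead_entryMove]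

lemma target_walk_succ (hw : h < w.length) :
    target w (.walk m) (h + 1) b = (.reading (.walk m), if b then h + 2 else h) := by
  cases b <;> simp [target, tapeSymbolAt_letter hw, outcome, moveHead, hw]

lemma target_walk_rightEnd (hw : w.length < h) : target w (.walk m) h b = (.reject, h) := by
  simp [target, tapeSymbolAt_rightEnd hw, outcome, moveHead]

lemma target_act_rightEnd (hw : w.length < h) : target w (.act m u) h b = (.reject, h) := by
  simp [target, tapeSymbolAt_rightEnd hw, outcome, react, moveHead]

lemma target_act_lap {d : Bool} (hw : h ≤ w.length) :
    target w (.act (.lap d) u) h b = (.reading (.check (.lap d) u), h + 1) := by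
  rcases hx : tapeSymbolAt w h with _ | _ | _
  · simp [target, hx, outcome, react, moveHead_right hw]
  · simp [target, hx, outcome, react, moveHead_right hw]
  · exact absurd hx (tapeSymbolAt_ne_rightEnd hw)

lemma target_act_whole (hw : h ≤ w.length) :
    target w (.act .whole u) h b = (.reading (.check .whole u), h + 1) := by
  rcases hx : tapeSymbolAt w h with _ | _ | _
  · simp [target, hx, outcome, react, moveHead_right hw]
  · simp [target, hx, outcome, react, moveHead_right hw]
  · exact absurd hx (tapeSymbolAt_ne_rightEnd hw)

lemma target_act_up_unmarked {j : ZMod 64} (hw : h ≤ w.length) (hu : u.chain = false) :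
    target w (.act (.up j) u) h b =
      (.communicating (.up (j + 1)), if j = 63 then h + 1 else h) := by
  rcases hx : tapeSymbolAt w h with _ | _ | _
  · by_cases hj : j = 63 <;> simp [target, hx, outcome, react, hu, hj, moveHead, hw]
  · by_cases hj : j = 63 <;> simp [target, hx, outcome, react, hu, hj, moveHead, hw]
  · exact absurd hx (tapeSymbolAt_ne_rightEnd hw)

lemma target_act_up_turn (hw : h ≤ w.length) (hu : u.chain = true) :
    target w (.act (.up 63) u) h b = (.communicating .down, h + 1) := by
  rcases hx : tapeSymbolAt w h with _ | _ | _
  · simp [target, hx, outcome, react, hu, moveHead_right hw]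
  · simp [target, hx, outcome, react, hu, moveHead_right hw]
  · exact absurd hx (tapeSymbolAt_ne_rightEnd hw)

lemma target_act_up_accept (hu : u.chain = true) :
    target w (.act (.up 0) u) 0 b = (.accept, 0) := by
  simp [target, tapeSymbolAt, outcome, react, hu, moveHead, show (0 : ZMod 64) ≠ 63 by decide]

lemma target_act_up_reject {j : ZMod 64} (hu : u.chain = true) (hj : j ≠ 63)
    (h0 : h ≠ 0 ∨ j ≠ 0) : target w (.act (.up j) u) h b = (.reject, h) := by
  rcases h with _ | h
  · have hj0 : j ≠ 0 := h0.resolve_left (by simp)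
    simp [target, tapeSymbolAt, outcome, react, hu, hj, hj0, moveHead]
  · rcases hx : tapeSymbolAt w (h + 1) with _ | _ | _
    · exact absurd hx (tapeSymbolAt_ne_leftEnd w h)
    all_goals simp [target, hx, outcome, react, hu, hj, moveHead]

lemma target_act_down_zero : target w (.act .down u) 0 b = (.reject, 0) := by
  simp [target, tapeSymbolAt, outcome, react, moveHead]

lemma target_act_down_succ (hw : h < w.length) :
    target w (.act .down u) (h + 1) b = (.reading (.check .down u), h) := by
  simp [target, tapeSymbolAt_letter hw, outcome, react, moveHead]

lemma target_act_cnt {s : ZMod 64} (hw : h ≤ w.length) :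
    target w (.act (.cnt s) u) h b =
      (.reading (.check (.cnt s) u), if b then h + 1 else h) := by
  rcases hx : tapeSymbolAt w h with _ | _ | _
  · cases b <;> simp [target, hx, outcome, react, moveHead, hw]
  · cases b <;> simp [target, hx, outcome, react, moveHead, hw]
  · exact absurd hx (tapeSymbolAt_ne_rightEnd hw)

lemma target_check : target w (.check m u) h b = (verdict u m (tapeSymbolAt w h), h) := rfl

lemma verdict_lap_rightEnd {d : Bool} (hw : w.length < h) :
    verdict u (.lap d) (tapeSymbolAt w h) =
      if u.mark d then (if u.both then .accept else .reading (.ret (.lap d))) else .reject := by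
  rw [tapeSymbolAt_rightEnd hw, verdict]

lemma verdict_lap_of_le {d : Bool} (hw : h ≤ w.length) :
    verdict u (.lap d) (tapeSymbolAt w h) =
      if u.mark d then .reject else .communicating (.lap d) := by
  rw [verdict]
  exact fun hx => tapeSymbolAt_ne_rightEnd hw hx

lemma verdict_whole_rightEnd (hw : w.length < h) :
    verdict u .whole (tapeSymbolAt w h) =
      if u.chain then .reading (.ret (.up 0)) else .reject := by
  rw [tapeSymbolAt_rightEnd hw, verdict]

lemma verdict_whole_of_le (hw : h ≤ w.length) :
    verdict u .whole (tapeSymbolAt w h) =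
      if u.chain then .reject else .communicating .whole := by
  rw [verdict]
  exact fun hx => tapeSymbolAt_ne_rightEnd hw hx

lemma verdict_down_zero :
    verdict u .down (tapeSymbolAt w 0) =
      if u.chain then .reading (.ret (.up 0)) else .reject := rfl

lemma verdict_down_succ :
    verdict u .down (tapeSymbolAt w (h + 1)) =
      if u.chain then .reject else .communicating .down := by
  rw [verdict]
  exact fun hx => tapeSymbolAt_ne_leftEnd w h hx

lemma verdict_cnt_rightEnd {s : ZMod 64} (hw : w.length < h) :
    verdict u (.cnt s) (tapeSymbolAt w h) =
      if u.both then decision (s + 1) else .reading (.ret (.cnt (s + 1))) := by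
  rw [tapeSymbolAt_rightEnd hw, verdict]

lemma verdict_cnt_of_le {s : ZMod 64} (hw : h ≤ w.length) :
    verdict u (.cnt s) (tapeSymbolAt w h) =
      if u.both then decision s else .communicating (.cnt s) := by
  rw [verdict]
  exact fun hx => tapeSymbolAt_ne_rightEnd hw hx

end target

section Value

open TwoPFAVerifier

variable (θ : unitInterval) (w : List Unit)

/-- The expectation of a function of the state and the head position after one step from a reading
state. -/
noncomputable def average (F : State × ℕ → ℝ) (s : Control) (h : ℕ) : ℝ :=
  bias θ s * F (target w s h true) + (1 - bias θ s) * F (target w s h false)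

variable {θ w} in
lemma average_of_const {F : State × ℕ → ℝ} {s : Control} {h : ℕ} {p : State × ℕ}
    (hp : ∀ b, target w s h b = p) : average θ w F s h = F p := by
  rw [average, hp, hp]
  ring

/-- The configuration with a given state and head position, after the messages `l`. -/
def conf (p : State × ℕ) (l : List CertSymbol) : (verifier θ).Config := ⟨p.1, p.2, l⟩

variable {θ}

/-- The sequence of replies of a prover. -/
def certificate (P : (verifier θ).Prover) (w : List Unit) (t : ℕ) : CertSymbol :=
  P w (List.replicate (t + 1) (default : CertSymbol))

variable {w} (P : (verifier θ).Prover)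

lemma next_reading (f : (verifier θ).Config → ℝ≥0∞) (s : Control) (h : ℕ)
    (l : List CertSymbol) :
    (verifier θ).next P w f (conf θ (.reading s, h) l) =
      ENNReal.ofReal (bias θ s) * f (conf θ (target w s h true) l) +
      ENNReal.ofReal (1 - bias θ s) * f (conf θ (target w s h false) l) := by
  change expectation (PMF.map _ (PMF.map _ (coin (bias θ s)))) f = _
  rw [expectation_map, expectation_map, expectation_coin]
  rfl

lemma next_communicating (f : (verifier θ).Config → ℝ≥0∞) (m : Mode) (h : ℕ)
    (l : List CertSymbol) :
    (verifier θ).next P w f (conf θ (.communicating m, h) l) =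
      f (conf θ (.reading (.act m (P w (l ++ [default]))), h) (l ++ [default])) :=
  expectation_pure _ _

/-- A bounded function `v` of the number of messages, the state and the head position that equals
its expectation after one step and takes the values `a` and `r` where the verifier has accepted and
rejected, when the replies of the prover are `σ 0, σ 1, …`. -/
structure IsValue (θ : unitInterval) (w : List Unit) (σ : ℕ → CertSymbol) (a r : ℝ)
    (v : ℕ → State × ℕ → ℝ) : Prop where
  nonneg : ∀ t p, 0 ≤ v t p
  le_one : ∀ t p, v t p ≤ 1
  accept : ∀ t h, v t (.accept, h) = a
  reject : ∀ t h, v t (.reject, h) = r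
  communicating : ∀ t m h, v t (.communicating m, h) = v (t + 1) (.reading (.act m (σ t)), h)
  reading : ∀ t s h, v t (.reading s, h) = average θ w (v t) s h

lemma isValue_haltProb {q : VerifierState Control Mode}
    (hq : IsHalting (V := verifier θ) q) {a r : ℝ}
    (ha : ∀ h l, ((verifier θ).inState q (conf θ (.accept, h) l)).toReal = a)
    (hr : ∀ h l, ((verifier θ).inState q (conf θ (.reject, h) l)).toReal = r) :
    IsValue θ w (certificate P w) a r
      fun t p => ((verifier θ).haltProb P w q (conf θ p (.replicate t default))).toReal where
  nonneg _ _ := ENNReal.toReal_nonneg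
  le_one t p := ENNReal.toReal_le_of_le_ofReal zero_le_one
    (by simpa using (verifier θ).haltProb_le_one P w q _)
  accept t h := by rw [haltProb_of_isHalting _ _ _ (.inl rfl), ha]
  reject t h := by rw [haltProb_of_isHalting _ _ _ (.inr rfl), hr]
  communicating t m h := by
    rw [← next_haltProb P w hq, next_communicating, certificate, List.replicate_succ']
  reading t s h := by
    have hne (p : ℝ) (c) : ENNReal.ofReal p * (verifier θ).haltProb P w q c ≠ ∞ :=
      ENNReal.mul_ne_top ENNReal.ofReal_ne_top
        (ne_top_of_le_ne_top ENNReal.one_ne_top ((verifier θ).haltProb_le_one P w q c))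
    have hbias := (bias θ s).2
    rw [← next_haltProb P w hq, next_reading, average, ENNReal.toReal_add (hne _ _) (hne _ _),
      ENNReal.toReal_mul, ENNReal.toReal_mul, ENNReal.toReal_ofReal hbias.1,
      ENNReal.toReal_ofReal (sub_nonneg.2 hbias.2)]

lemma isValue_acceptProb :
    IsValue θ w (certificate P w) 1 0
      fun t p => ((verifier θ).haltProb P w .accept (conf θ p (.replicate t default))).toReal :=
  isValue_haltProb P (.inl rfl) (by simp [inState, conf]) (by simp [inState, conf])

lemma isValue_rejectProb :
    IsValue θ w (certificate P w) 0 1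
      fun t p => ((verifier θ).haltProb P w .reject (conf θ p (.replicate t default))).toReal :=
  isValue_haltProb P (.inr rfl) (by simp [inState, conf]) (by simp [inState, conf])

end Value

/-- The probability that the verifier gives up between two cycles: it starts the random walk with
probability `1 / 64`, and the walk from position `1` reaches position `n + 1` before position `0`
with probability `1 / (n + 1)`. -/
noncomputable def lapse (n : ℕ) : ℝ := 1 / (64 * (n + 1))

lemma lapse_pos (n : ℕ) : 0 < lapse n := by unfold lapse; positivity

lemma lapse_le (n : ℕ) : lapse n ≤ 1 / 64 := by
  unfold lapse
  gcongr
  linarith [n.cast_nonneg (α := ℝ)]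

lemma eq_add_mul_sub_of_midpoint {f : ℕ → ℝ} {n : ℕ}
    (hf : ∀ h < n, f (h + 1) = (f (h + 2) + f h) / 2) :
    ∀ h ≤ n + 1, f h = f 0 + h * (f 1 - f 0) := by
  have slope : ∀ h ≤ n, f (h + 1) - f h = f 1 - f 0 := by
    intro h
    induction h with
    | zero => simp
    | succ h ih => intro hh; linarith [hf h hh, ih (by omega)]
  intro h
  induction h with
  | zero => simp
  | succ h ih => intro hh; push_cast; linarith [slope h (by omega), ih (by omega)]

namespace IsValue

variable {θ : unitInterval} {w : List Unit} {σ : ℕ → CertSymbol} {a r : ℝ}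
  {v : ℕ → State × ℕ → ℝ}

lemma reading_eq (hv : IsValue θ w σ a r v) {s : Control} {t h : ℕ} {p : State × ℕ}
    (hp : ∀ b, target w s h b = p) : v t (.reading s, h) = v t p := by
  rw [hv.reading, average_of_const hp]

lemma communicating_eq (hv : IsValue θ w σ a r v) {m : Mode} {t h : ℕ} {p : State × ℕ}
    (hp : ∀ b, target w (.act m (σ t)) h b = p) :
    v t (.communicating m, h) = v (t + 1) p := by
  rw [hv.communicating, hv.reading_eq hp]

lemma check (hv : IsValue θ w σ a r v) (m : Mode) (u : CertSymbol) (t h : ℕ) :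
    v t (.reading (.check m u), h) = v t (verdict u m (tapeSymbolAt w h), h) :=
  hv.reading_eq fun _ => target_check _

lemma ret (hv : IsValue θ w σ a r v) (m : Mode) (t h : ℕ) :
    v t (.reading (.ret m), h) = v t (.reading (.ret m), 0) := by
  induction h with
  | zero => rfl
  | succ h ih => rw [hv.reading_eq target_ret_succ, ih]

lemma walk_one (hv : IsValue θ w σ a r v) (m : Mode) (t : ℕ) :
    v t (.reading (.walk m), 1) =
      (w.length * v t (.communicating m, entryPos m) + r) / (w.length + 1) := by
  have hleft : v t (.reading (.walk m), 0) = v t (.communicating m, entryPos m) :=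
    hv.reading_eq target_walk_zero
  have hright : v t (.reading (.walk m), w.length + 1) = r := by
    rw [hv.reading_eq fun b => target_walk_rightEnd b (Nat.lt_succ_self _), hv.reject]
  have hmidpoint : ∀ h < w.length, v t (.reading (.walk m), h + 1) =
      (v t (.reading (.walk m), h + 2) + v t (.reading (.walk m), h)) / 2 := by
    intro h hh
    rw [hv.reading, average, target_walk_succ _ hh, target_walk_succ _ hh]
    simp only [bias, if_true, Bool.false_eq_true, if_false]
    ring
  have haffine := eq_add_mul_sub_of_midpoint (f := fun h => v t (.reading (.walk m), h))
    hmidpoint (w.length + 1) le_rfl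
  rw [hright, hleft] at haffine
  push_cast at haffine
  rw [eq_div_iff (by positivity)]
  linarith

lemma cycle (hv : IsValue θ w σ a r v) (m : Mode) (t h : ℕ) :
    v t (.reading (.ret m), h) =
      (1 - lapse w.length) * v t (.communicating m, entryPos m) + lapse w.length * r := by
  rw [hv.ret, hv.reading, average, target_ret_zero, target_ret_zero]
  simp only [bias, if_true, Bool.false_eq_true, if_false, hv.walk_one, lapse]
  field_simp
  ring

lemma cycle_le (hv : IsValue θ w σ a r v) (hr : r ≤ 1) (m : Mode) (t h : ℕ) :
    v t (.reading (.ret m), h) ≤ v t (.communicating m, entryPos m) + lapse w.length := by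
  rw [hv.cycle]
  nlinarith [hv.nonneg t (.communicating m, entryPos m), lapse_pos w.length]

lemma cycle_zero (hv : IsValue θ w σ a 0 v) (m : Mode) (t h : ℕ) :
    v t (.reading (.ret m), h) =
      (1 - lapse w.length) * v t (.communicating m, entryPos m) := by
  rw [hv.cycle]
  ring

lemma init_of_length_le_one (hv : IsValue θ w σ a r v) (hw : w.length ≤ 1) :
    v 0 (.reading (.look 0), 0) = r := by
  match w, hw with
  | [], _ =>
    rw [hv.reading_eq (p := (.reading (.look 1), 1)) fun _ => rfl,
      hv.reading_eq (p := (.reject, 1)) fun _ => rfl, hv.reject]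
  | [()], _ =>
    rw [hv.reading_eq (p := (.reading (.look 1), 1)) fun _ => rfl,
      hv.reading_eq (p := (.reading (.look 2), 2)) fun _ => rfl,
      hv.reading_eq (p := (.reject, 2)) fun _ => rfl, hv.reject]

lemma pick (hv : IsValue θ w σ a r v) (i : Fin 5) (t h : ℕ) :
    v t (.reading (.pick i), h) =
      1 / (9 - (i : ℕ)) * v t (.reading (.ret (startMode i)), 0) +
      (1 - 1 / (9 - (i : ℕ))) * v t (if i = 4 then .reject else .reading (.pick (i + 1)), h) := by
  rw [hv.reading, ← hv.ret _ t h]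
  rfl

lemma look_zero (hv : IsValue θ w σ a r v) (hw : 2 ≤ w.length) :
    v 0 (.reading (.look 0), 0) = v 0 (.reading (.pick 0), 2) := by
  match w, hw with
  | () :: () :: _, _ =>
    rw [hv.reading_eq (p := (.reading (.look 1), 1)) fun _ => rfl,
      hv.reading_eq (p := (.reading (.look 2), 2)) fun _ => rfl,
      hv.reading_eq (p := (.reading (.pick 0), 2)) fun _ => rfl]

lemma init_eq (hv : IsValue θ w σ a r v) (hw : 2 ≤ w.length) :
    v 0 (.reading (.look 0), 0) = (v 0 (.reading (.ret (.lap false)), 0) +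
      v 0 (.reading (.ret (.lap true)), 0) + v 0 (.reading (.ret .whole), 0) +
      v 0 (.reading (.ret (.up 0)), 0) + v 0 (.reading (.ret (.cnt 0)), 0) + 4 * r) / 9 := by
  have h0 := hv.pick 0 0 2
  have h1 := hv.pick 1 0 2
  have h2 := hv.pick 2 0 2
  have h3 := hv.pick 3 0 2
  have h4 := hv.pick 4 0 2
  simp only [startMode, hv.reject, Fin.reduceEq, if_true, if_false, Fin.reduceAdd]
    at h0 h1 h2 h3 h4
  norm_num at h0 h1 h2 h3 h4
  rw [hv.look_zero hw]
  linarith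

end IsValue

/-- The first index at which `μ` holds is `E`. -/
def IsFirstMark (μ : ℕ → Bool) (E : ℕ) : Prop := (∀ i < E, μ i = false) ∧ μ E = true

lemma IsFirstMark.unique {μ : ℕ → Bool} {E E' : ℕ} (h : IsFirstMark μ E)
    (h' : IsFirstMark μ E') : E = E' := by
  refine le_antisymm (not_lt.1 fun hlt => ?_) (not_lt.1 fun hlt => ?_)
  · simpa [h.1 E' hlt] using h'.2
  · simpa [h'.1 E hlt] using h.2

/-- The values `g 0, …, g E` of a scan for a mark that should appear first at `E`: the scan ends
with the value `r` if the mark appears too early or not at all, and with the value `z` otherwise. -/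
structure IsScan (g : ℕ → ℝ) (μ : ℕ → Bool) (E : ℕ) (r z : ℝ) : Prop where
  step : ∀ i < E, g i = if μ i then r else g (i + 1)
  last : g E = if μ E then z else r

namespace IsScan

variable {g : ℕ → ℝ} {μ : ℕ → Bool} {E : ℕ} {r z : ℝ}

lemma eq_of_isFirstMark (hg : IsScan g μ E r z) (hμ : IsFirstMark μ E) : g 0 = z := by
  have hconst : ∀ i ≤ E, g 0 = g i := by
    intro i
    induction i with
    | zero => simp
    | succ i ih => intro hi; simp [ih (by omega), hg.step i hi, hμ.1 i hi]
  rw [hconst E le_rfl, hg.last, if_pos hμ.2]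

lemma isFirstMark (hg : IsScan g μ E 0 z) (h0 : 0 < g 0) : IsFirstMark μ E := by
  have hprefix : ∀ i ≤ E, (∀ j < i, μ j = false) ∧ 0 < g i := by
    intro i
    induction i with
    | zero => simpa using h0
    | succ i ih =>
      intro hi
      obtain ⟨hμ, hpos⟩ := ih (by omega)
      rw [hg.step i hi] at hpos
      split_ifs at hpos with hmark
      · exact absurd hpos (lt_irrefl 0)
      · refine ⟨fun j hj => ?_, hpos⟩
        rcases Nat.lt_succ_iff_lt_or_eq.1 hj with hj | rfl
        · exact hμ j hj
        · simpa using hmark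
  obtain ⟨hμ, hpos⟩ := hprefix E le_rfl
  rw [hg.last] at hpos
  refine ⟨hμ, ?_⟩
  by_contra hmark
  simp [hmark] at hpos

end IsScan

lemma exists_pos_ne_mul_succ {x : ℕ → ℝ} {c : ℝ} (hx : ∀ j, x j ≤ 1) (hc0 : 0 ≤ c) (hc1 : c < 1)
    (h0 : 0 < x 0) : ∃ j, (∀ i ≤ j, 0 < x i) ∧ x j ≠ c * x (j + 1) := by
  by_contra! hcon
  have hgeom (j : ℕ) : (∀ i ≤ j, 0 < x i) ∧ x 0 = c ^ j * x j := by
    induction j with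
    | zero => simpa using h0
    | succ j ih =>
      obtain ⟨hpos, heq⟩ := ih
      have hstep := hcon j hpos
      have hnext : 0 < x (j + 1) := pos_of_mul_pos_right (hstep ▸ hpos j le_rfl) hc0
      refine ⟨fun i hi => ?_, by rw [heq, hstep]; ring⟩
      rcases Nat.le_succ_iff.1 hi with hi | rfl
      · exact hpos i hi
      · exact hnext
  obtain ⟨j, hj⟩ := exists_pow_lt_of_lt_one h0 hc1
  nlinarith [(hgeom j).2, hx j, pow_nonneg hc0 j]

section Period

/-- The period of the track `mark d`. -/
def period (n : ℕ) (d : Bool) : ℕ := n + d.toNat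

lemma entryPos_add_period (n : ℕ) (d : Bool) : entryPos (.lap d) + period n d = n + 1 := by
  cases d <;> simp [entryPos, period, add_comm]

lemma period_pos {n : ℕ} (hn : 0 < n) (d : Bool) : 0 < period n d := Nat.add_pos_left hn _

lemma CertSymbol.both_iff {u : CertSymbol} : u.both = true ↔ ∀ d, u.mark d = true := by
  simp [CertSymbol.both]

lemma iff_dvd_of_isFirstMark {μ : ℕ → Bool} {p j : ℕ} (hp : 0 < p)
    (hμ : ∀ i ≤ j, IsFirstMark (fun e => μ (i * p + e)) (p - 1)) :
    ∀ i < (j + 1) * p, μ i = true ↔ p ∣ i + 1 := by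
  intro i hi
  have hmod : i % p < p := Nat.mod_lt i hp
  obtain ⟨hbefore, hlast⟩ := hμ (i / p) (Nat.lt_succ_iff.1 ((Nat.div_lt_iff_lt_mul hp).2 hi))
  simp only at hbefore hlast
  have hi_eq : i / p * p + i % p = i := Nat.div_add_mod' i p
  have hdvd : p ∣ i + 1 ↔ i % p = p - 1 := by
    rw [← hi_eq, add_assoc, Nat.dvd_add_right (Dvd.intro_left _ rfl), hi_eq]
    refine ⟨fun h => ?_, fun h => ?_⟩
    · have := Nat.le_of_dvd (Nat.succ_pos _) h
      omega
    · rw [h, Nat.sub_add_cancel hp]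
  rw [hdvd]
  rcases Nat.lt_or_ge (i % p) (p - 1) with h | h
  · have := hbefore _ h
    rw [hi_eq] at this
    simp [this, h.ne]
  · obtain h : i % p = p - 1 := by omega
    rw [← h, hi_eq] at hlast
    simp [hlast, h]

/-- As `n` and `n + 1` are coprime, correct period marks first coincide at `n * (n + 1)`. -/
lemma isFirstMark_both {σ : ℕ → CertSymbol} {n : ℕ} (hn : 0 < n)
    (h : ∀ d, ∃ T, (σ T).both = true ∧ ∀ i ≤ T, (σ i).mark d = true ↔ period n d ∣ i + 1) :
    IsFirstMark (fun i => (σ i).both) (n * (n + 1) - 1) := by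
  obtain ⟨T, hT, hmark⟩ : ∃ T, (σ T).both = true ∧
      ∀ i ≤ T, ∀ d, (σ i).mark d = true ↔ period n d ∣ i + 1 := by
    obtain ⟨T₀, hT₀, h₀⟩ := h false
    obtain ⟨T₁, hT₁, h₁⟩ := h true
    refine ⟨min T₀ T₁, ?_, fun i hi d => ?_⟩
    · rcases min_choice T₀ T₁ with h | h <;> rwa [h]
    · cases d
      · exact h₀ i (hi.trans (min_le_left _ _))
      · exact h₁ i (hi.trans (min_le_right _ _))
  have hpos : 0 < n * (n + 1) := by positivity
  have hboth : ∀ i ≤ T, (σ i).both = true ↔ n * (n + 1) ∣ i + 1 := by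
    intro i hi
    have hcoprime : Nat.Coprime n (n + 1) := by simp
    rw [CertSymbol.both_iff, Bool.forall_bool, hmark i hi, hmark i hi]
    exact ⟨fun h => hcoprime.mul_dvd_of_dvd_of_dvd h.1 h.2,
      fun h => ⟨dvd_of_mul_right_dvd h, dvd_of_mul_left_dvd h⟩⟩
  have hle : n * (n + 1) ≤ T + 1 := Nat.le_of_dvd (Nat.succ_pos T) ((hboth T le_rfl).1 hT)
  refine ⟨fun i hi => ?_, (hboth _ (by omega)).2 (by rw [Nat.sub_add_cancel hpos])⟩
  rw [← Bool.not_eq_true, hboth i (by omega)]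
  exact Nat.not_dvd_of_pos_of_lt (Nat.succ_pos i) (by omega)

end Period

namespace IsValue

variable {θ : unitInterval} {w : List Unit} {σ : ℕ → CertSymbol} {a r : ℝ}
  {v : ℕ → State × ℕ → ℝ}

lemma lap_isScan (hv : IsValue θ w σ a r v) (hw : 0 < w.length) (d : Bool) (t : ℕ) :
    IsScan (fun i => v (t + i) (.communicating (.lap d), entryPos (.lap d) + i))
      (fun i => (σ (t + i)).mark d) (period w.length d - 1) r
      (if (σ (t + (period w.length d - 1))).both then a
        else v (t + period w.length d) (.reading (.ret (.lap d)), 0)) where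
  step i hi := by
    have hentry := entryPos_add_period w.length d
    rw [hv.communicating_eq fun b => target_act_lap b (by omega), hv.check,
      verdict_lap_of_le (by omega)]
    split_ifs
    · exact hv.reject _ _
    · rfl
  last := by
    have hentry := entryPos_add_period w.length d
    have hpos := period_pos hw d
    rw [hv.communicating_eq fun b => target_act_lap b (by omega), hv.check,
      verdict_lap_rightEnd (by omega),
      ← hv.ret _ _ (entryPos (.lap d) + (period w.length d - 1) + 1),
      show t + (period w.length d - 1) + 1 = t + period w.length d by omega]
    split_ifs
    · exact hv.accept _ _
    · rfl
    · exact hv.reject _ _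

lemma exists_both_of_lap_pos (hv : IsValue θ w σ a 0 v) (hw : 0 < w.length) (d : Bool)
    (h0 : 0 < v 0 (.communicating (.lap d), entryPos (.lap d))) :
    ∃ T, (σ T).both = true ∧ ∀ i ≤ T, (σ i).mark d = true ↔ period w.length d ∣ i + 1 := by
  set p := period w.length d with hp
  have hp0 : 0 < p := period_pos hw d
  let x (j : ℕ) : ℝ := v (j * p) (.communicating (.lap d), entryPos (.lap d))
  have hlapse := lapse_pos w.length
  have hlapse' := lapse_le w.length
  obtain ⟨j, hpos, hne⟩ := exists_pos_ne_mul_succ (x := x) (c := 1 - lapse w.length)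
    (fun j => hv.le_one _ _) (by linarith) (by linarith) (by simpa [x] using h0)
  have hmark : ∀ i ≤ j, IsFirstMark (fun e => (σ (i * p + e)).mark d) (p - 1) :=
    fun i hi => (hv.lap_isScan hw d (i * p)).isFirstMark (hpos i hi)
  have hlen : (j + 1) * p = j * p + (p - 1) + 1 := by rw [add_one_mul]; omega
  refine ⟨j * p + (p - 1), ?_, fun i hi =>
    iff_dvd_of_isFirstMark (μ := fun i => (σ i).mark d) hp0 hmark i (by omega)⟩
  by_contra hboth
  have hlap : x j = v (j * p + p) (.reading (.ret (.lap d)), 0) := by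
    simpa [← hp, hboth] using
      (hv.lap_isScan hw d (j * p)).eq_of_isFirstMark (hmark j le_rfl)
  rw [hv.cycle_zero, ← add_one_mul] at hlap
  exact hne hlap

lemma lap_le (hv : IsValue θ w σ 0 1 v) (hw : 0 < w.length) (d : Bool) (k : ℕ)
    (hmark : ∀ j ≤ k, IsFirstMark (fun e => (σ (j * period w.length d + e)).mark d)
      (period w.length d - 1))
    (hboth : (σ (k * period w.length d + (period w.length d - 1))).both = true) :
    v 0 (.communicating (.lap d), entryPos (.lap d)) ≤ k * lapse w.length := by
  set p := period w.length d with hp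
  have hl := lapse_pos w.length
  suffices h : ∀ i j, i + j = k →
      v (j * p) (.communicating (.lap d), entryPos (.lap d)) ≤ i * lapse w.length by
    simpa using h k 0 rfl
  intro i
  induction i with
  | zero =>
    rintro j rfl
    have hlap := (hv.lap_isScan hw d (j * p)).eq_of_isFirstMark (hmark j (by omega))
    simp only [← hp, add_zero] at hlap
    simp only [zero_add] at hboth
    simp [hlap, hboth]
  | succ i ih =>
    intro j hj
    have hlap := (hv.lap_isScan hw d (j * p)).eq_of_isFirstMark (hmark j (by omega))
    simp only [← hp, add_zero, ← add_one_mul] at hlap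
    rw [hlap]
    push_cast
    split_ifs
    · positivity
    · linarith [hv.cycle_le le_rfl (.lap d) ((j + 1) * p) 0, ih (j + 1) (by omega)]

end IsValue

lemma exists_isFirstMark {μ : ℕ → Bool} {i : ℕ} (hi : μ i = true) :
    ∃ E ≤ i, IsFirstMark μ E := by
  classical
  have hex : ∃ i, μ i = true := ⟨i, hi⟩
  exact ⟨Nat.find hex, Nat.find_min' hex hi,
    fun i hi => by simpa using Nat.find_min hex hi, Nat.find_spec hex⟩

/-- The certificate `σ` has a block of length `D` starting at the index `t`. -/
def IsBlock (σ : ℕ → CertSymbol) (t D : ℕ) : Prop :=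
  0 < D ∧ IsFirstMark (fun i => (σ (t + i)).chain) (D - 1)

lemma IsBlock.unique {σ : ℕ → CertSymbol} {t D D' : ℕ} (h : IsBlock σ t D)
    (h' : IsBlock σ t D') : D = D' := by
  have := h.2.unique h'.2
  have := h.1
  have := h'.1
  omega

lemma natCast_eq_63_iff {E : ℕ} : (E : ZMod 64) = 63 ↔ E % 64 = 63 :=
  ZMod.natCast_eq_natCast_iff' E 63 64

namespace IsValue

variable {θ : unitInterval} {w : List Unit} {σ : ℕ → CertSymbol} {a r : ℝ}
  {v : ℕ → State × ℕ → ℝ}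

lemma communicating_of_length_lt (hv : IsValue θ w σ a r v) {m : Mode} {t h : ℕ}
    (hw : w.length < h) : v t (.communicating m, h) = r := by
  rw [hv.communicating_eq fun b => target_act_rightEnd b hw, hv.reject]

lemma whole_isScan (hv : IsValue θ w σ a r v) (hw : 0 < w.length) :
    IsScan (fun i => v i (.communicating .whole, 1 + i)) (fun i => (σ i).chain) (w.length - 1) r
      (v w.length (.reading (.ret (.up 0)), 0)) where
  step i hi := by
    rw [hv.communicating_eq fun b => target_act_whole b (by omega), hv.check,
      verdict_whole_of_le (by omega)]
    split_ifs
    · exact hv.reject _ _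
    · rfl
  last := by
    rw [hv.communicating_eq fun b => target_act_whole b (by omega), hv.check,
      verdict_whole_rightEnd (by omega), Nat.sub_add_cancel hw,
      ← hv.ret _ _ (1 + (w.length - 1) + 1)]
    split_ifs
    · rfl
    · exact hv.reject _ _

lemma up_run (hv : IsValue θ w σ a r v) {t E : ℕ} (hE : E ≤ 64 * (w.length + 1))
    (hσ : ∀ i < E, (σ (t + i)).chain = false) :
    v t (.communicating (.up 0), 0) = v (t + E) (.communicating (.up E), E / 64) := by
  induction E with
  | zero => simp
  | succ E ih =>
    have hstep := hv.communicating_eq fun b =>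
      target_act_up_unmarked b (j := E) (h := E / 64) (w := w) (by omega) (hσ E (by omega))
    rw [ih (by omega) fun i hi => hσ i (by omega), hstep, add_assoc, Nat.cast_succ]
    simp only [natCast_eq_63_iff]
    congr 2
    split_ifs <;> omega

lemma up_of_isBlock (hv : IsValue θ w σ a r v) {t D : ℕ} (hD : D ≤ w.length + 1)
    (hσ : IsBlock σ t (64 * D)) :
    v t (.communicating (.up 0), 0) = v (t + 64 * D) (.communicating .down, D) := by
  obtain ⟨hpos, hbefore, hlast⟩ := hσ
  rw [hv.up_run (by omega) hbefore, natCast_eq_63_iff.2 (by omega),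
    hv.communicating_eq fun b => target_act_up_turn b (by omega) hlast,
    show t + (64 * D - 1) + 1 = t + 64 * D by omega, show (64 * D - 1) / 64 + 1 = D by omega]

lemma up_of_chain (hv : IsValue θ w σ a r v) {t : ℕ} (hσ : (σ t).chain = true) :
    v t (.communicating (.up 0), 0) = a := by
  rw [hv.communicating_eq fun b => target_act_up_accept b hσ, hv.accept]

lemma chain_or_isBlock_of_up_pos (hv : IsValue θ w σ a 0 v) {t : ℕ}
    (h0 : 0 < v t (.communicating (.up 0), 0)) :
    (σ t).chain = true ∨ ∃ D ≤ w.length + 1, IsBlock σ t (64 * D) := by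
  obtain ⟨E, hE, hfirst⟩ : ∃ E < 64 * (w.length + 1),
      IsFirstMark (fun i => (σ (t + i)).chain) E := by
    by_contra! hnone
    have hunmarked : ∀ i < 64 * (w.length + 1), (σ (t + i)).chain = false := by
      intro i hi
      by_contra hmark
      obtain ⟨E, hE, hfirst⟩ := exists_isFirstMark (μ := fun i => (σ (t + i)).chain)
        (eq_true_of_ne_false hmark)
      exact hnone E (hE.trans_lt hi) hfirst
    rw [hv.up_run le_rfl hunmarked, hv.communicating_of_length_lt (by omega)] at h0
    exact lt_irrefl 0 h0
  rcases Nat.eq_zero_or_pos E with rfl | hpos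
  · exact .inl hfirst.2
  · have hmod : E % 64 = 63 := by
      by_contra hmod
      have hne : E / 64 ≠ 0 ∨ (E : ZMod 64) ≠ 0 := by
        rw [Ne, Ne, ZMod.natCast_eq_zero_iff]
        omega
      rw [hv.up_run hE.le hfirst.1, hv.communicating_eq fun b =>
        target_act_up_reject b hfirst.2 (natCast_eq_63_iff.not.2 hmod) hne, hv.reject] at h0
      exact lt_irrefl 0 h0
    refine .inr ⟨E / 64 + 1, by omega, by omega, ?_⟩
    rwa [show 64 * (E / 64 + 1) - 1 = E by omega]

lemma down_isScan (hv : IsValue θ w σ a r v) {t D : ℕ} (hD0 : 0 < D) (hD : D ≤ w.length) :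
    IsScan (fun i => v (t + i) (.communicating .down, D - i)) (fun i => (σ (t + i)).chain)
      (D - 1) r (v (t + D) (.reading (.ret (.up 0)), 0)) where
  step i hi := by
    obtain ⟨h, rfl⟩ : ∃ h, D = h + 1 + i + 1 := ⟨D - i - 2, by omega⟩
    rw [show h + 1 + i + 1 - i = h + 1 + 1 by omega, show h + 1 + i + 1 - (i + 1) = h + 1 by omega,
      hv.communicating_eq fun b => target_act_down_succ b (by omega), hv.check, verdict_down_succ]
    split_ifs
    · exact hv.reject _ _
    · rfl
  last := by
    rw [show D - (D - 1) = 0 + 1 by omega,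
      hv.communicating_eq fun b => target_act_down_succ b (by omega), hv.check, verdict_down_zero,
      show t + (D - 1) + 1 = t + D by omega]
    split_ifs
    · rfl
    · exact hv.reject _ _

lemma pair_eq (hv : IsValue θ w σ a r v) {t D : ℕ} (hD : D ≤ w.length)
    (h₁ : IsBlock σ t (64 * D)) (h₂ : IsBlock σ (t + 64 * D) D) :
    v t (.communicating (.up 0), 0) = v (t + 64 * D + D) (.reading (.ret (.up 0)), 0) := by
  rw [hv.up_of_isBlock (hD.trans (Nat.le_succ _)) h₁]
  exact (hv.down_isScan h₂.1 hD).eq_of_isFirstMark h₂.2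

lemma pair_sound (hv : IsValue θ w σ a 0 v) {t : ℕ}
    (h0 : 0 < v t (.communicating (.up 0), 0)) :
    (σ t).chain = true ∨ ∃ D, IsBlock σ t (64 * D) ∧ IsBlock σ (t + 64 * D) D ∧
      0 < v (t + 64 * D + D) (.communicating (.up 0), 0) := by
  refine (hv.chain_or_isBlock_of_up_pos h0).imp_right ?_
  rintro ⟨D, hD, h₁⟩
  have hD0 : 0 < D := Nat.pos_of_mul_pos_left h₁.1
  have hdown := h0
  rw [hv.up_of_isBlock hD h₁] at hdown
  have hDw : D ≤ w.length := by
    by_contra! hlt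
    rw [hv.communicating_of_length_lt hlt] at hdown
    exact lt_irrefl 0 hdown
  have h₂ : IsBlock σ (t + 64 * D) D := ⟨hD0, (hv.down_isScan hD0 hDw).isFirstMark hdown⟩
  rw [hv.pair_eq hDw h₁ h₂, hv.cycle_zero] at h0
  exact ⟨D, h₁, h₂, pos_of_mul_pos_right h0 (by linarith [lapse_le w.length])⟩

/-- The pairs that start at the first and at the second block overlap, so together they check that
every block is `64` times as long as the next one. -/
lemma chain_sound (hv : IsValue θ w σ a 0 v) {t D : ℕ} (hD : IsBlock σ t D)
    (h₁ : 0 < v t (.communicating (.up 0), 0))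
    (h₂ : 0 < v (t + D) (.communicating (.up 0), 0)) : ∃ j, D = 64 ^ j := by
  induction D using Nat.strong_induction_on generalizing t with
  | _ D ih =>
    rcases hv.pair_sound h₁ with hlast | ⟨D', hb₁, hb₂, h₃⟩
    · exact ⟨0, hD.unique ⟨one_pos, by simp, hlast⟩⟩
    · obtain rfl := hD.unique hb₁
      have := hb₂.1
      obtain ⟨j, rfl⟩ := ih D' (by omega) hb₂ h₂ h₃
      exact ⟨j + 1, by ring⟩

lemma chain_le (hv : IsValue θ w σ 0 1 v) {e : ℕ → ℕ} {k : ℕ} (hk : 64 ^ k ≤ w.length)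
    (he : ∀ j ≤ k, e j = e (j + 1) + 64 ^ j) (hblock : ∀ j ≤ k, IsBlock σ (e (j + 1)) (64 ^ j))
    (hlast : (σ (e 0)).chain = true) :
    ∀ j ≤ k + 1, v (e j) (.communicating (.up 0), 0) ≤ j * lapse w.length := by
  have hl := lapse_pos w.length
  intro j
  induction j using Nat.twoStepInduction with
  | zero => simp [hv.up_of_chain hlast]
  | one =>
    intro _
    have hmark := (hblock 0 (Nat.zero_le k)).2.2
    rw [hv.up_of_chain (by simpa using hmark)]
    positivity
  | more j ih _ =>
    intro hj
    have h₁ := hblock (j + 1) (by omega)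
    have h₂ := hblock j (by omega)
    rw [he (j + 1) (by omega), pow_succ'] at h₂
    rw [pow_succ'] at h₁
    have hpair := hv.pair_eq ((Nat.pow_le_pow_right (by norm_num) (by omega)).trans hk) h₁ h₂
    rw [← pow_succ', ← he (j + 1) (by omega), ← he j (by omega)] at hpair
    have hcycle := hv.cycle_le le_rfl (.up 0) (e j) 0
    have := ih (by omega)
    rw [hpair]
    push_cast
    change _ ≤ v (e j) (.communicating (.up 0), 0) + _ at hcycle
    linarith

end IsValue

/-- The end of the block of length `64 ^ j` in the chain of blocks of lengths
`64 ^ k, …, 64, 1`. -/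
def chainEnd (k j : ℕ) : ℕ := ∑ i ∈ Finset.Ico j (k + 1), 64 ^ i

lemma chainEnd_antitone (k : ℕ) : Antitone (chainEnd k) := fun _ _ h =>
  Finset.sum_le_sum_of_subset (Finset.Ico_subset_Ico_left h)

lemma chainEnd_succ_self (k : ℕ) : chainEnd k (k + 1) = 0 := by simp [chainEnd]

lemma chainEnd_eq_add {k j : ℕ} (hj : j ≤ k) : chainEnd k j = chainEnd k (j + 1) + 64 ^ j := by
  rw [chainEnd, Finset.sum_eq_sum_Ico_succ_bot (by omega), add_comm, chainEnd]

open Classical in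
/-- The correct certificate for an input of length `64 ^ k`. After the last block of the chain there
is one more mark, at the index `chainEnd k 0`: it lets the check of a pair that starts there
accept. -/
noncomputable def honest (k i : ℕ) : CertSymbol where
  mark d := decide (period (64 ^ k) d ∣ i + 1)
  chain := decide ((∃ j ≤ k, i + 1 = chainEnd k j) ∨ i = chainEnd k 0)

lemma honest_mark {k i : ℕ} {d : Bool} :
    (honest k i).mark d = true ↔ period (64 ^ k) d ∣ i + 1 := by
  simp [honest]

lemma honest_chain {k i : ℕ} :
    (honest k i).chain = true ↔ (∃ j ≤ k, i + 1 = chainEnd k j) ∨ i = chainEnd k 0 := by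
  simp [honest]

lemma honest_isBlock {k j : ℕ} (hj : j ≤ k) :
    IsBlock (honest k) (chainEnd k (j + 1)) (64 ^ j) := by
  have hpos : 0 < 64 ^ j := by positivity
  have heq := chainEnd_eq_add hj
  refine ⟨hpos, fun i hi => ?_, honest_chain.2 (.inl ⟨j, hj, by omega⟩)⟩
  rw [← Bool.not_eq_true, honest_chain, not_or]
  have hlast := chainEnd_antitone k (Nat.zero_le j)
  refine ⟨?_, by omega⟩
  rintro ⟨j', -, h⟩
  rcases Nat.lt_or_ge j j' with hlt | hge
  · have := chainEnd_antitone k (Nat.succ_le_of_lt hlt)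
    simp only [Nat.succ_eq_add_one] at this
    omega
  · have := chainEnd_antitone k hge
    omega

/-- A bound for the probability of a wrong verdict on the number of heads when `x` heads have been
counted, `m` tosses remain and the head position is `h`: the second moment of the distance of the
final number of heads from `μ`, divided by `W ^ 2`, plus `lapse n` for each completed pass, of which
there are at most `(h + m) / (n + 1)`. -/
noncomputable def countBound (θ μ W : ℝ) (n m : ℕ) (x h : ℝ) : ℝ :=
  ((x + m * θ - μ) ^ 2 + m * (θ * (1 - θ))) / W ^ 2 + lapse n * ((h + m) / (n + 1))

section countBound

variable {θ μ W x h : ℝ} {n m : ℕ}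

lemma countBound_average_le (hθ : θ ≤ 1) :
    θ * countBound θ μ W n m (x + 1) (h + 1) + (1 - θ) * countBound θ μ W n m x h ≤
      countBound θ μ W n (m + 1) x h := by
  have hmoment : θ * (((x + 1 + m * θ - μ) ^ 2 + m * (θ * (1 - θ))) / W ^ 2) +
      (1 - θ) * (((x + m * θ - μ) ^ 2 + m * (θ * (1 - θ))) / W ^ 2) =
      ((x + (m + 1) * θ - μ) ^ 2 + (m + 1) * (θ * (1 - θ))) / W ^ 2 := by ring
  have hlapse : (1 - θ) * (lapse n * ((h + m) / (n + 1))) ≤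
      (1 - θ) * (lapse n * ((h + (m + 1)) / (n + 1))) := by
    have := lapse_pos n
    have := sub_nonneg.2 hθ
    gcongr
    linarith
  simp only [countBound]
  push_cast
  rw [add_assoc h 1, add_comm 1 (m : ℝ)]
  linarith

lemma countBound_zero_add_lapse :
    countBound θ μ W n m x 0 + lapse n = countBound θ μ W n m x (n + 1) := by
  have hn : (n : ℝ) + 1 ≠ 0 := by positivity
  simp only [countBound]
  field_simp
  ring

lemma one_le_countBound (hW : 0 < W) (hh : 0 ≤ h) (hx : W ≤ |x - μ|) :
    1 ≤ countBound θ μ W n 0 x h := by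
  have := lapse_pos n
  have hsq : W ^ 2 ≤ (x - μ) ^ 2 := by
    rw [← sq_abs (x - μ)]
    gcongr
  simp only [countBound, Nat.cast_zero, zero_mul, add_zero]
  refine le_add_of_le_of_nonneg ((one_le_div (by positivity)).2 hsq) (by positivity)

lemma countBound_nonneg (hh : 0 ≤ h) : 0 ≤ countBound θ μ W n 0 x h := by
  have := lapse_pos n
  simp only [countBound, Nat.cast_zero, zero_mul, add_zero]
  positivity

lemma countBound_mean_le (hθ : θ ∈ Set.Icc 0 1) (hm : m = n * (n + 1)) :
    countBound θ (n * (n + 1) * θ) (15 * (n + 1)) n m 0 0 ≤ 1 / 64 + n * lapse n := by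
  have hvar : θ * (1 - θ) ≤ 1 := by nlinarith [hθ.1, hθ.2]
  have hmoment : n * (n + 1) * (θ * (1 - θ)) / (15 * (n + 1)) ^ 2 ≤ (1 / 64 : ℝ) := by
    rw [div_le_iff₀ (by positivity)]
    nlinarith [mul_le_mul_of_nonneg_left hvar (show (0 : ℝ) ≤ n * (n + 1) by positivity)]
  simp only [countBound, hm]
  push_cast
  rw [zero_add, zero_add, sub_self, zero_pow two_ne_zero, zero_add, mul_div_assoc (n : ℝ),
    div_self (by positivity), mul_one, mul_comm (lapse n)]
  gcongr

end countBound

namespace IsValue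

variable {θ : unitInterval} {w : List Unit} {σ : ℕ → CertSymbol} {u : CertSymbol} {a r : ℝ}
  {v : ℕ → State × ℕ → ℝ} {μ W : ℝ} {m t q h : ℕ}

lemma communicating_cnt_le (hv : IsValue θ w σ a r v) (hh : h ≤ w.length)
    (hcheck : ∀ h ≤ w.length + 1, v (t + 1) (.reading (.check (.cnt q) (σ t)), h) ≤
      countBound θ μ W w.length m (q * (w.length + 1) + h) h) :
    v t (.communicating (.cnt q), h) ≤
      countBound θ μ W w.length (m + 1) (q * (w.length + 1) + h) h := by
  rw [hv.communicating, hv.reading, average, target_act_cnt _ hh, target_act_cnt _ hh]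
  have htail := hcheck h (by omega)
  have hhead := hcheck (h + 1) (by omega)
  push_cast at hhead
  rw [← add_assoc] at hhead
  exact (add_le_add (mul_le_mul_of_nonneg_left hhead θ.2.1)
    (mul_le_mul_of_nonneg_left htail (sub_nonneg.2 θ.2.2))).trans (countBound_average_le θ.2.2)

lemma check_cnt_le (hv : IsValue θ w σ a r v) (hr : r ≤ 1) (hu : u.both = false)
    (hh : h ≤ w.length + 1)
    (hnext : ∀ q h, h ≤ w.length → v t (.communicating (.cnt (q : ℕ)), h) ≤
      countBound θ μ W w.length m (q * (w.length + 1) + h) h) :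
    v t (.reading (.check (.cnt q) u), h) ≤
      countBound θ μ W w.length m (q * (w.length + 1) + h) h := by
  rw [hv.check]
  rcases Nat.le_or_eq_of_le_succ hh with hle | rfl
  · rw [verdict_cnt_of_le hle, hu]
    exact hnext q h hle
  · rw [verdict_cnt_rightEnd (Nat.lt_succ_self _), hu]
    have hcycle := hv.cycle_le hr (.cnt (q + 1)) t (w.length + 1)
    have hpass := hnext (q + 1) 0 (Nat.zero_le _)
    push_cast at hpass
    rw [add_zero, add_one_mul] at hpass
    push_cast
    rw [← countBound_zero_add_lapse]
    exact hcycle.trans (add_le_add_left hpass _)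

lemma check_cnt_of_both (hv : IsValue θ w σ a r v) (hu : u.both = true)
    (hh : h ≤ w.length + 1) :
    v t (.reading (.check (.cnt q) u), h) =
      v t (decision (((q * (w.length + 1) + h) / (w.length + 1) : ℕ)), h) := by
  rw [hv.check, mul_comm, Nat.mul_add_div (Nat.succ_pos _)]
  rcases Nat.le_or_eq_of_le_succ hh with hle | rfl
  · rw [verdict_cnt_of_le hle, hu, Nat.div_eq_of_lt (Nat.lt_succ_of_le hle)]
    rfl
  · rw [verdict_cnt_rightEnd (Nat.lt_succ_self _), hu, Nat.div_self (Nat.succ_pos _)]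
    simp

/-- Chebyshev's inequality for the number of heads, by backward induction on the number of
tosses. -/
lemma cnt_le_countBound (hv : IsValue θ w σ a r v) (hr : r ≤ 1) {T : ℕ}
    (hT : IsFirstMark (fun i => (σ i).both) T) (hW : 0 < W)
    (hdec : ∀ x : ℕ, |x - μ| < W →
      ∀ t h, v t (decision ((x / (w.length + 1) : ℕ)), h) = 0) :
    v 0 (.communicating (.cnt 0), 0) ≤ countBound θ μ W w.length (T + 1) 0 0 := by
  have hcheck : ∀ m t, t + m = T → ∀ q h : ℕ, h ≤ w.length + 1 →
      v (t + 1) (.reading (.check (.cnt q) (σ t)), h) ≤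
        countBound θ μ W w.length m (q * (w.length + 1) + h) h := by
    intro m
    induction m with
    | zero =>
      intro t ht q h hh
      obtain rfl : t = T := ht
      rw [hv.check_cnt_of_both hT.2 hh]
      rcases lt_or_ge |((q * (w.length + 1) + h : ℕ) : ℝ) - μ| W with hnear | hfar
      · rw [hdec _ hnear]
        exact countBound_nonneg h.cast_nonneg
      · push_cast at hfar
        exact (hv.le_one _ _).trans (one_le_countBound hW h.cast_nonneg hfar)
    | succ m ih =>
      intro t ht q h hh
      exact hv.check_cnt_le hr (hT.1 t (by omega)) hh fun q h hh =>
        hv.communicating_cnt_le hh (ih (t + 1) (by omega) q)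
  have hstart := hv.communicating_cnt_le (q := 0) (Nat.zero_le _) (hcheck T 0 (zero_add T) 0)
  simpa using hstart

lemma cnt_le (hv : IsValue θ w σ a r v) (hr : r ≤ 1) (hw : 0 < w.length)
    (hT : IsFirstMark (fun i => (σ i).both) (w.length * (w.length + 1) - 1))
    (hdec : ∀ x : ℕ, |x - w.length * (w.length + 1) * (θ : ℝ)| < 15 * (w.length + 1) →
      ∀ t h, v t (decision ((x / (w.length + 1) : ℕ)), h) = 0) :
    v 0 (.communicating (.cnt 0), 0) ≤ 1 / 64 + w.length * lapse w.length :=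
  (hv.cnt_le_countBound hr hT (by positivity) hdec).trans
    (countBound_mean_le θ.2 (Nat.sub_add_cancel (Nat.mul_pos hw (Nat.succ_pos _))))

end IsValue

section Digits

lemma mul_ofDigits_eq {b : ℕ} (d : ℕ → Fin b) :
    b * Real.ofDigits d = d 0 + Real.ofDigits fun i => d (i + 1) := by
  have hb : (b : ℝ) ≠ 0 := Nat.cast_ne_zero.2 (Fin.pos (d 0)).ne'
  rw [Real.ofDigits_eq_sum_add_ofDigits d 1, Finset.sum_range_one, Real.ofDigitsTerm,
    zero_add, pow_one]
  field_simp

lemma exists_pow_mul_ofDigits_eq {b : ℕ} (d : ℕ → Fin b) (k : ℕ) :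
    ∃ E : ℕ, b ^ k * Real.ofDigits d = E + Real.ofDigits fun i => d (k + i) := by
  induction k with
  | zero => exact ⟨0, by simp⟩
  | succ k ih =>
    obtain ⟨E, hE⟩ := ih
    have hshift : (fun i => d (k + (i + 1))) = fun i => d (k + 1 + i) :=
      funext fun i => congrArg d (by ring)
    refine ⟨b * E + d k, ?_⟩
    rw [pow_succ', mul_assoc, hE, mul_add, mul_ofDigits_eq, hshift, add_zero]
    push_cast
    ring

lemma exists_pow_succ_mul_ofDigits_eq {b : ℕ} (d : ℕ → Fin b) (k : ℕ) :
    ∃ E : ℕ, ∃ ρ ∈ Set.Icc (0 : ℝ) 1, b ^ (k + 1) * Real.ofDigits d = b * E + d k + ρ := by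
  obtain ⟨E, hE⟩ := exists_pow_mul_ofDigits_eq d k
  refine ⟨E, _, ⟨Real.ofDigits_nonneg fun i => d (k + (i + 1)), Real.ofDigits_le_one _⟩, ?_⟩
  rw [pow_succ', mul_assoc, hE, mul_add, mul_ofDigits_eq, ← add_assoc, add_zero]

open Classical in
/-- The base-`64` digits of the bias of the counting coin: the digit at the index `k - 1` encodes
whether `k` belongs to `I`, and it is far from the multiples of `32`, where the verdict on the
number of passes changes. -/
noncomputable def digit (I : Set ℕ+) (i : ℕ) : Fin 64 := if i.succPNat ∈ I then 48 else 16

/-- The bias of the counting coin that encodes the set `I`. -/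
noncomputable def countBias (I : Set ℕ+) : unitInterval :=
  ⟨Real.ofDigits (digit I), Real.ofDigits_nonneg _, Real.ofDigits_le_one _⟩

lemma quarter_le_countBias (I : Set ℕ+) : 1 / 4 ≤ (countBias I : ℝ) := by
  have hdigit : (16 : ℝ) ≤ (digit I 0 : ℕ) := by
    unfold digit
    split_ifs <;> norm_num
  have htail := Real.ofDigits_nonneg fun i => digit I (i + 1)
  have hshift := mul_ofDigits_eq (digit I)
  change 1 / 4 ≤ Real.ofDigits (digit I)
  push_cast at hshift
  linarith

lemma div_near_of_abs_sub_lt {n x E d : ℕ} {θ ρ : ℝ} (hρ : ρ ∈ Set.Icc 0 1)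
    (hθ : n * θ = 64 * E + d + ρ) (hx : |x - n * (n + 1) * θ| < 15 * (n + 1)) :
    64 * E + d < x / (n + 1) + 16 ∧ x / (n + 1) < 64 * E + d + 16 := by
  have hn : (0 : ℝ) < n + 1 := by positivity
  have hmean : n * (n + 1) * θ = (64 * E + d + ρ) * (n + 1) := by rw [← hθ]; ring
  rw [hmean, abs_lt] at hx
  have hle : ((x / (n + 1) : ℕ) : ℝ) * (n + 1) ≤ x := by
    exact_mod_cast Nat.div_mul_le_self x (n + 1)
  have hlt : (x : ℝ) < ((x / (n + 1) : ℕ) + 1) * (n + 1) := by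
    rw [mul_comm]
    exact_mod_cast Nat.lt_mul_div_succ x (Nat.succ_pos n)
  have hlower : (64 * E + d + ρ - 15 : ℝ) < (x / (n + 1) : ℕ) + 1 :=
    lt_of_mul_lt_mul_right (by linarith) hn.le
  have hupper : ((x / (n + 1) : ℕ) : ℝ) < 64 * E + d + ρ + 15 :=
    lt_of_mul_lt_mul_right (by linarith) hn.le
  have hlower' : (64 * E + d : ℝ) < (x / (n + 1) : ℕ) + 16 := by linarith [hρ.1]
  have hupper' : ((x / (n + 1) : ℕ) : ℝ) < 64 * E + d + 16 := by linarith [hρ.2]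
  exact ⟨by exact_mod_cast hlower', by exact_mod_cast hupper'⟩

/-- A number of heads near its mean yields the correct verdict. -/
lemma decision_of_abs_sub_lt {I : Set ℕ+} {k : ℕ+} {n x : ℕ} (hn : n = 64 ^ (k : ℕ))
    (hx : |x - n * (n + 1) * (countBias I : ℝ)| < 15 * (n + 1)) :
    (k ∈ I → decision (x / (n + 1) : ℕ) = .accept) ∧
      (k ∉ I → decision (x / (n + 1) : ℕ) = .reject) := by
  obtain ⟨i, rfl⟩ : ∃ i : ℕ, k = i.succPNat := ⟨k.natPred, by simp⟩
  obtain ⟨E, ρ, hρ, hE⟩ := exists_pow_succ_mul_ofDigits_eq (digit I) i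
  have hθ : n * (countBias I : ℝ) = 64 * E + (digit I i : ℕ) + ρ := by
    simpa [hn, countBias] using hE
  have hnear := div_near_of_abs_sub_lt hρ hθ hx
  simp only [decision, ZMod.val_natCast]
  refine ⟨fun hk => if_pos ?_, fun hk => if_neg ?_⟩
  · obtain h : (digit I i : ℕ) = 48 := by simp [digit, hk]
    omega
  · obtain h : (digit I i : ℕ) = 16 := by simp [digit, hk]
    omega

end Digits

lemma val_add_one : ∀ {j : ZMod 64}, j ≠ 63 → (j + 1).val = j.val + 1 := by decide

/-- A bound on the expected time until the end of a cycle of the mode `m`, from the head position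
`h`, for an input of length `n`. -/
noncomputable def cycleTime (n : ℕ) (m : Mode) (h : ℕ) : ℝ :=
  match m with
  | .up j => 4 * (n + 1) + 127 + 2 * (64 * (n + 1 - h) - j.val)
  | .down => n + 2 + 3 * h
  | _ => n + 2 + 12 * (n + 1 - h)

/-- A bound on the expected remaining time, for an input of length `n`. The verifier stops with
probability `1 / (64 * (n + 1))` between two cycles, and a cycle takes at most `260 * (n + 1)`
steps in expectation, whence the leading coefficient `64 * 260 + 1`. -/
noncomputable def timeBound (n : ℕ) : State × ℕ → ℝ
  | (.reading (.look i), h) => 16641 * (n + 1) ^ 2 + h + 11 - 2 * (i : ℕ)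
  | (.reading (.pick i), h) => 16641 * (n + 1) ^ 2 + h + 6 - (i : ℕ)
  | (.reading (.ret _), h) => 16641 * (n + 1) ^ 2 + h + 1
  | (.reading (.walk _), h) => (n + 1 - h) * (h + 16641 * (n + 1) + 260) + 1
  | (.reading (.act m _), h) => 16641 * (n + 1) ^ 2 + cycleTime n m h - 1
  | (.reading (.check m _), h) => 16641 * (n + 1) ^ 2 + cycleTime n m h + 1
  | (.communicating m, h) => 16641 * (n + 1) ^ 2 + cycleTime n m h
  | (.accept, _) => 0
  | (.reject, _) => 0

section Time

variable {n h : ℕ} {w : List Unit}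

lemma le_cycleTime (m : Mode) (hh : h ≤ n + 1) : (n : ℝ) + 2 ≤ cycleTime n m h := by
  have hh' : (h : ℝ) ≤ n + 1 := by exact_mod_cast hh
  rcases m with d | _ | j | _ | s <;> simp only [cycleTime] <;> try linarith
  have hj : (j.val : ℝ) ≤ 63 := by exact_mod_cast Nat.le_of_lt_succ (ZMod.val_lt j)
  linarith

lemma cycleTime_entryPos_le (n : ℕ) (m : Mode) : cycleTime n m (entryPos m) ≤ 260 * (n + 1) := by
  rcases m with (_ | _) | _ | j | _ | s <;> simp only [cycleTime, entryPos] <;> push_cast <;>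
    linarith

lemma timeBound_nonneg {p : State × ℕ} (hp : p.2 ≤ n + 1) : 0 ≤ timeBound n p := by
  obtain ⟨q, h⟩ := p
  have hp' : (h : ℝ) ≤ n + 1 := by exact_mod_cast hp
  have hsq : (0 : ℝ) ≤ 16641 * (n + 1) ^ 2 := by positivity
  rcases q with (i | i | m | m | ⟨m, u⟩ | ⟨m, u⟩) | m | _ | _ <;> simp only [timeBound]
  · have hi : ((i : ℕ) : ℝ) ≤ 2 := by exact_mod_cast Nat.le_of_lt_succ i.2
    linarith
  · have hi : ((i : ℕ) : ℝ) ≤ 4 := by exact_mod_cast Nat.le_of_lt_succ i.2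
    linarith
  · linarith
  · positivity
  all_goals first | exact le_rfl | linarith [le_cycleTime m hp]

lemma timeBound_decision (s : ZMod 64) (h : ℕ) : timeBound n (decision s, h) = 0 := by
  unfold decision
  split_ifs <;> rfl

lemma moveHead_le (hh : h ≤ w.length + 1) (d : HeadMove) : moveHead w h d ≤ w.length + 1 := by
  cases d <;> simp only [moveHead] <;> omega

lemma one_add_average_le {θ : unitInterval} {F : State × ℕ → ℝ} {s : Control} {B : ℝ}
    (hF : ∀ b, 1 + F (target w s h b) ≤ B) : 1 + average θ w F s h ≤ B := by
  have htrue := mul_le_mul_of_nonneg_left (hF true) (bias θ s).2.1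
  have hfalse := mul_le_mul_of_nonneg_left (hF false) (sub_nonneg.2 (bias θ s).2.2)
  rw [average]
  linarith

lemma one_add_timeBound_look (i : Fin 3) (b : Bool) :
    1 + timeBound w.length (target w (.look i) h b) ≤
      timeBound w.length (.reading (.look i), h) := by
  have hright : (moveHead w h .right : ℝ) ≤ h + 1 := by
    exact_mod_cast min_le_left (h + 1) (w.length + 1)
  have hstay : moveHead w h .stay = h := rfl
  have hreject : 1 ≤ 16641 * ((w.length : ℝ) + 1) ^ 2 + h := by
    nlinarith [(w.length.cast_nonneg : (0 : ℝ) ≤ w.length), (h.cast_nonneg : (0 : ℝ) ≤ h)]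
  fin_cases i <;> rcases hx : tapeSymbolAt w h with _ | _ | _ <;>
    simp [target, hx, outcome, timeBound, hstay] <;> linarith

lemma one_add_timeBound_pick (i : Fin 5) (b : Bool) :
    1 + timeBound w.length (target w (.pick i) h b) ≤
      timeBound w.length (.reading (.pick i), h) := by
  have hreject : 1 ≤ 16641 * ((w.length : ℝ) + 1) ^ 2 + h := by
    nlinarith [(w.length.cast_nonneg : (0 : ℝ) ≤ w.length), (h.cast_nonneg : (0 : ℝ) ≤ h)]
  fin_cases i <;> cases b <;> simp [target, outcome, timeBound, moveHead] <;> linarith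

lemma one_add_average_ret (θ : unitInterval) (m : Mode) :
    1 + average θ w (timeBound w.length) (.ret m) h ≤
      timeBound w.length (.reading (.ret m), h) := by
  rcases h with _ | h
  · have hentry := cycleTime_entryPos_le w.length m
    simp only [average, target_ret_zero, bias, timeBound, if_true, Bool.false_eq_true, if_false]
    push_cast
    nlinarith
  · refine one_add_average_le fun b => ?_
    rw [target_ret_succ]
    simp only [timeBound]
    push_cast
    linarith

lemma one_add_average_walk (θ : unitInterval) (m : Mode) (hh : h ≤ w.length + 1) :
    1 + average θ w (timeBound w.length) (.walk m) h ≤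
      timeBound w.length (.reading (.walk m), h) := by
  rcases hh.eq_or_lt with rfl | hlt
  · refine one_add_average_le fun b => ?_
    simp [target_walk_rightEnd b w.length.lt_succ_self, timeBound]
  rcases h with _ | h
  · refine one_add_average_le fun b => ?_
    have hentry := cycleTime_entryPos_le w.length m
    simp only [target_walk_zero, timeBound]
    push_cast
    linarith
  · simp only [average, target_walk_succ _ (Nat.succ_lt_succ_iff.1 hlt), bias, timeBound, if_true,
      Bool.false_eq_true, if_false]
    push_cast
    linarith

lemma one_add_timeBound_up {j : ZMod 64} {u : CertSymbol} (hh : h ≤ w.length) (b : Bool) :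
    1 + timeBound w.length (target w (.act (.up j) u) h b) ≤
      timeBound w.length (.reading (.act (.up j) u), h) := by
  have hh' : (h : ℝ) ≤ w.length := by exact_mod_cast hh
  have hreject : 1 ≤ timeBound w.length (.reading (.act (.up j) u), h) := by
    have hcycle := le_cycleTime (.up j) (hh.trans (Nat.le_succ _))
    simp only [timeBound]
    nlinarith [(w.length.cast_nonneg : (0 : ℝ) ≤ w.length)]
  cases hu : u.chain
  · rw [target_act_up_unmarked b hh hu]
    split_ifs with hj
    · subst hj
      simp only [timeBound, cycleTime, show ((63 : ZMod 64) + 1).val = 0 by decide,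
        show (63 : ZMod 64).val = 63 by decide]
      push_cast
      linarith
    · simp only [timeBound, cycleTime, val_add_one hj]
      push_cast
      linarith
  by_cases hj : j = 63
  · subst hj
    rw [target_act_up_turn b hh hu]
    simp only [timeBound, cycleTime, show (63 : ZMod 64).val = 63 by decide]
    push_cast
    linarith
  by_cases h0 : h ≠ 0 ∨ j ≠ 0
  · rw [target_act_up_reject b hu hj h0]
    simpa only [timeBound, add_zero] using hreject
  · obtain ⟨rfl, rfl⟩ : h = 0 ∧ j = 0 := by simpa using h0
    rw [target_act_up_accept b hu]
    simpa only [timeBound, add_zero] using hreject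

lemma one_add_average_act {θ : unitInterval} (hθ : 1 / 4 ≤ (θ : ℝ)) (m : Mode) (u : CertSymbol)
    (hh : h ≤ w.length + 1) :
    1 + average θ w (timeBound w.length) (.act m u) h ≤
      timeBound w.length (.reading (.act m u), h) := by
  have hcycle := le_cycleTime m hh
  rcases lt_or_ge w.length h with hlt | hle
  · refine one_add_average_le fun b => ?_
    simp only [target_act_rightEnd b hlt, timeBound]
    nlinarith
  rcases m with d | _ | j | _ | s
  · refine one_add_average_le fun b => ?_
    simp only [target_act_lap b hle, timeBound, cycleTime]
    push_cast
    linarith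
  · refine one_add_average_le fun b => ?_
    simp only [target_act_whole b hle, timeBound, cycleTime]
    push_cast
    linarith
  · exact one_add_average_le (one_add_timeBound_up hle)
  · refine one_add_average_le fun b => ?_
    rcases h with _ | h
    · simp only [target_act_down_zero, timeBound]
      nlinarith
    · simp only [target_act_down_succ b hle, timeBound, cycleTime]
      push_cast
      linarith
  · simp only [average, target_act_cnt _ hle, bias, timeBound, cycleTime, if_true,
      Bool.false_eq_true, if_false]
    push_cast
    linarith

lemma one_add_timeBound_check (m : Mode) (u : CertSymbol) (hh : h ≤ w.length + 1) :
    1 + timeBound w.length (verdict u m (tapeSymbolAt w h), h) ≤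
      timeBound w.length (.reading (.check m u), h) := by
  have hh' : (h : ℝ) ≤ w.length + 1 := by exact_mod_cast hh
  have hsq : (0 : ℝ) ≤ 16641 * (w.length + 1) ^ 2 := by positivity
  have hcycle := le_cycleTime m hh
  rcases m with d | _ | j | _ | s <;> rcases tapeSymbolAt w h with _ | _ | _ <;>
    simp only [verdict] <;> (try split_ifs) <;> (try rw [timeBound_decision]) <;>
    simp only [timeBound, cycleTime] at hcycle ⊢ <;> linarith

lemma one_add_average_timeBound_le {θ : unitInterval} (hθ : 1 / 4 ≤ (θ : ℝ)) (s : Control)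
    (hh : h ≤ w.length + 1) :
    1 + average θ w (timeBound w.length) s h ≤ timeBound w.length (.reading s, h) :=
  match s with
  | .look i => one_add_average_le (one_add_timeBound_look i)
  | .pick i => one_add_average_le (one_add_timeBound_pick i)
  | .ret m => one_add_average_ret θ m
  | .walk m => one_add_average_walk θ m hh
  | .act m u => one_add_average_act hθ m u hh
  | .check m u => one_add_average_le fun b => by
      rw [target_check]
      exact one_add_timeBound_check m u hh

end Time

section QuadraticTime

open TwoPFAVerifier

variable {θ : unitInterval} {w : List Unit}

/-- The time bound as a function of the configuration. A head position beyond the tape, which is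
never reached, gets the value `∞`. -/
noncomputable def configTime (w : List Unit) (c : (verifier θ).Config) : ℝ≥0∞ :=
  if c.head ≤ w.length + 1 then ENNReal.ofReal (timeBound w.length (c.state, c.head)) else ∞

lemma configTime_conf {p : State × ℕ} (hp : p.2 ≤ w.length + 1) (l : List CertSymbol) :
    configTime w (conf θ p l) = ENNReal.ofReal (timeBound w.length p) := if_pos hp

lemma one_add_next_configTime_reading (hθ : 1 / 4 ≤ (θ : ℝ)) (P : (verifier θ).Prover)
    (s : Control) {h : ℕ} (hh : h ≤ w.length + 1) (l : List CertSymbol) :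
    1 + (verifier θ).next P w (configTime w) (conf θ (.reading s, h) l) ≤
      configTime w (conf θ (.reading s, h) l) := by
  have htarget (b : Bool) : (target w s h b).2 ≤ w.length + 1 := moveHead_le hh _
  have hnonneg (b : Bool) := timeBound_nonneg (htarget b)
  have hbias := (bias θ s).2.1
  have hbias' := sub_nonneg.2 (bias θ s).2.2
  have htrue := mul_nonneg hbias (hnonneg true)
  have hfalse := mul_nonneg hbias' (hnonneg false)
  calc 1 + (verifier θ).next P w (configTime w) (conf θ (.reading s, h) l)
      = ENNReal.ofReal (1 + average θ w (timeBound w.length) s h) := by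
        rw [next_reading, configTime_conf (htarget _), configTime_conf (htarget _),
          ← ENNReal.ofReal_mul hbias, ← ENNReal.ofReal_mul hbias',
          ← ENNReal.ofReal_add htrue hfalse, ← ENNReal.ofReal_one,
          ← ENNReal.ofReal_add zero_le_one (add_nonneg htrue hfalse), average]
    _ ≤ configTime w (conf θ (.reading s, h) l) := by
        rw [configTime_conf hh]
        exact ENNReal.ofReal_le_ofReal (one_add_average_timeBound_le hθ s hh)

lemma one_add_next_configTime_communicating (P : (verifier θ).Prover) (m : Mode) {h : ℕ}
    (hh : h ≤ w.length + 1) (l : List CertSymbol) :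
    1 + (verifier θ).next P w (configTime w) (conf θ (.communicating m, h) l) =
      configTime w (conf θ (.communicating m, h) l) := by
  rw [next_communicating, configTime_conf hh, configTime_conf hh, ← ENNReal.ofReal_one,
    ← ENNReal.ofReal_add zero_le_one (timeBound_nonneg hh)]
  congr 1
  simp only [timeBound]
  ring

lemma one_add_next_configTime_le (hθ : 1 / 4 ≤ (θ : ℝ)) (P : (verifier θ).Prover)
    {c : (verifier θ).Config} (hc : ¬IsHalting c.state) :
    1 + (verifier θ).next P w (configTime w) c ≤ configTime w c := by
  obtain ⟨q, h, l⟩ := c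
  by_cases hh : h ≤ w.length + 1
  · rcases q with s | m | _ | _
    · exact one_add_next_configTime_reading hθ P s hh l
    · exact (one_add_next_configTime_communicating P m hh l).le
    · exact absurd (.inl rfl) hc
    · exact absurd (.inr rfl) hc
  · simp [configTime, hh]

lemma expectedTime_le (hθ : 1 / 4 ≤ (θ : ℝ)) (P : (verifier θ).Prover) :
    (verifier θ).expectedTime P w ≤ ENNReal.ofReal (16641 * (w.length + 1) ^ 2 + 11) := by
  refine (expectedTime_le_of_drift _ P w fun c => one_add_next_configTime_le hθ P).trans_eq ?_
  simp [configTime, init, timeBound]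

lemma quadraticExpectedTime (hθ : 1 / 4 ≤ (θ : ℝ)) : (verifier θ).QuadraticExpectedTime := by
  refine ⟨33293, fun w P => (expectedTime_le hθ P).trans ?_⟩
  rw [← ENNReal.ofReal_natCast]
  refine ENNReal.ofReal_le_ofReal ?_
  push_cast
  nlinarith [sq_nonneg ((w.length : ℝ) - 1), sq_nonneg (w.length : ℝ)]

end QuadraticTime

lemma honest_isFirstMark_mark (k j : ℕ) (d : Bool) :
    IsFirstMark (fun e => (honest k (j * period (64 ^ k) d + e)).mark d)
      (period (64 ^ k) d - 1) := by
  have hmark (e : ℕ) :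
      (honest k (j * period (64 ^ k) d + e)).mark d = true ↔ period (64 ^ k) d ∣ e + 1 := by
    rw [honest_mark, add_assoc]
    exact Nat.dvd_add_right (Dvd.intro_left j rfl)
  refine ⟨fun e he => ?_, ?_⟩
  · rw [← Bool.not_eq_true, hmark]
    exact Nat.not_dvd_of_pos_of_lt e.succ_pos (by omega)
  · rw [hmark, Nat.sub_add_cancel (period_pos (by positivity) d)]

lemma honest_isFirstMark_both (k : ℕ) :
    IsFirstMark (fun i => (honest k i).both) (64 ^ k * (64 ^ k + 1) - 1) := by
  have hsucc : 64 ^ k * (64 ^ k + 1) - 1 + 1 = 64 ^ k * (64 ^ k + 1) :=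
    Nat.sub_add_cancel (Nat.mul_pos (by positivity) (Nat.succ_pos _))
  refine isFirstMark_both (by positivity) fun d =>
    ⟨64 ^ k * (64 ^ k + 1) - 1, ?_, fun i _ => honest_mark⟩
  rw [CertSymbol.both_iff]
  rintro (_ | _) <;> rw [honest_mark, hsucc]
  · exact Dvd.intro _ rfl
  · exact Dvd.intro_left _ rfl

lemma succ_mul_lapse (n : ℕ) : (n + 1) * lapse n = 1 / 64 := by
  unfold lapse
  field_simp

namespace IsValue

variable {θ : unitInterval} {w : List Unit} {σ : ℕ → CertSymbol} {a r : ℝ}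
  {v : ℕ → State × ℕ → ℝ} {I : Set ℕ+} {k : ℕ+}

lemma ret_cnt_le (hv : IsValue (countBias I) w σ a r v) (hr : r ≤ 1)
    (hw : w.length = 64 ^ (k : ℕ))
    (hT : IsFirstMark (fun i => (σ i).both) (w.length * (w.length + 1) - 1))
    (ha : k ∈ I → a = 0) (hr₀ : k ∉ I → r = 0) :
    v 0 (.reading (.ret (.cnt 0)), 0) ≤ 1 / 32 := by
  have hdec (x : ℕ) (hx : |x - w.length * (w.length + 1) * (countBias I : ℝ)| <
      15 * (w.length + 1)) (t h : ℕ) : v t (decision (x / (w.length + 1) : ℕ), h) = 0 := by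
    by_cases hk : k ∈ I
    · rw [(decision_of_abs_sub_lt hw hx).1 hk, hv.accept, ha hk]
    · rw [(decision_of_abs_sub_lt hw hx).2 hk, hv.reject, hr₀ hk]
  have hw₀ : 0 < w.length := by rw [hw]; positivity
  have hcnt := hv.cnt_le hr hw₀ hT hdec
  have hcycle := hv.cycle_le hr (.cnt 0) 0 0
  simp only [entryPos] at hcycle
  linarith [succ_mul_lapse w.length]

section Soundness

lemma communicating_pos_of_ret_pos (hv : IsValue θ w σ a 0 v) {m : Mode} {t h : ℕ}
    (hpos : 0 < v t (.reading (.ret m), h)) : 0 < v t (.communicating m, entryPos m) := by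
  rw [hv.cycle_zero] at hpos
  exact pos_of_mul_pos_right hpos (by linarith [lapse_le w.length])

lemma ret_startMode_pos (hv : IsValue θ w σ a 0 v) (hw : 2 ≤ w.length)
    (hinit : 4 / 9 < v 0 (.reading (.look 0), 0)) (i : Fin 5) :
    0 < v 0 (.reading (.ret (startMode i)), 0) := by
  have hle (i : Fin 5) := hv.le_one 0 (.reading (.ret (startMode i)), 0)
  have h0 := hle 0
  have h1 := hle 1
  have h2 := hle 2
  have h3 := hle 3
  have h4 := hle 4
  rw [hv.init_eq hw] at hinit
  simp only [startMode] at h0 h1 h2 h3 h4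
  fin_cases i <;> simp only [startMode] <;> linarith

lemma isFirstMark_both_of_ret_pos (hv : IsValue θ w σ a 0 v) (hw : 0 < w.length)
    (hpos : ∀ d, 0 < v 0 (.reading (.ret (.lap d)), 0)) :
    IsFirstMark (fun i => (σ i).both) (w.length * (w.length + 1) - 1) :=
  isFirstMark_both hw fun d =>
    hv.exists_both_of_lap_pos hw d (hv.communicating_pos_of_ret_pos (hpos d))

lemma exists_length_eq_pow (hv : IsValue θ w σ a 0 v) (hw : 0 < w.length)
    (hwhole : 0 < v 0 (.reading (.ret .whole), 0))
    (hup : 0 < v 0 (.reading (.ret (.up 0)), 0)) : ∃ j, w.length = 64 ^ j := by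
  have hscan := hv.whole_isScan hw
  have hpos := hv.communicating_pos_of_ret_pos hwhole
  have hmark := hscan.isFirstMark hpos
  have hblock : IsBlock σ 0 w.length := ⟨hw, by simpa using hmark⟩
  refine hv.chain_sound hblock (hv.communicating_pos_of_ret_pos hup) ?_
  rw [zero_add]
  exact hv.communicating_pos_of_ret_pos (hscan.eq_of_isFirstMark hmark ▸ hpos)

lemma soundness (hv : IsValue (countBias I) w σ 1 0 v) (hw : w ∉ UPOWER64 I) :
    v 0 (.reading (.look 0), 0) ≤ 23 / 50 := by
  by_contra! hinit
  have hlength : 2 ≤ w.length := by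
    by_contra! hlt
    rw [hv.init_of_length_le_one (Nat.le_of_lt_succ hlt)] at hinit
    norm_num at hinit
  have hw₀ : 0 < w.length := by omega
  have hpos := hv.ret_startMode_pos hlength (by linarith)
  have hboth := hv.isFirstMark_both_of_ret_pos hw₀ (Bool.forall_bool.2 ⟨hpos 0, hpos 1⟩)
  obtain ⟨j, hj⟩ := hv.exists_length_eq_pow hw₀ (hpos 2) (hpos 3)
  have hj₀ : 0 < j := Nat.pos_of_ne_zero fun h => by rw [h, pow_zero] at hj; omega
  lift j to ℕ+ using hj₀
  have hjI : j ∉ I := fun hjI => hw ⟨j, hjI, List.eq_replicate_iff.2 ⟨hj, fun _ _ => rfl⟩⟩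
  have hcnt := hv.ret_cnt_le zero_le_one hj hboth (absurd · hjI) fun _ => rfl
  have hle (m : Mode) := hv.le_one 0 (.reading (.ret m), 0)
  rw [hv.init_eq hlength] at hinit
  linarith [hle (.lap false), hle (.lap true), hle .whole, hle (.up 0)]

end Soundness

section Completeness

lemma ret_lap_le_of_honest {k : ℕ} (hv : IsValue θ w (honest k) 0 1 v) (hw : w.length = 64 ^ k)
    (d : Bool) : v 0 (.reading (.ret (.lap d)), 0) ≤ 1 / 64 := by
  have hw₀ : 0 < w.length := by rw [hw]; positivity
  obtain ⟨K, hK, hend⟩ : ∃ K ≤ w.length,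
      K * period w.length d + (period w.length d - 1) = w.length * (w.length + 1) - 1 := by
    obtain ⟨n, hn⟩ := Nat.exists_eq_succ_of_ne_zero hw₀.ne'
    cases d
    · refine ⟨w.length, le_rfl, ?_⟩
      simp only [period, Bool.toNat_false, hn, mul_add]
      omega
    · refine ⟨n, by omega, ?_⟩
      simp only [period, Bool.toNat_true, hn, Nat.succ_mul n]
      omega
  have hlap := hv.lap_le hw₀ d K (fun j _ => hw ▸ honest_isFirstMark_mark k j d)
    (by rw [hend, hw]; exact (honest_isFirstMark_both k).2)
  have hcycle := hv.cycle_le le_rfl (.lap d) 0 0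
  have hK' : (K : ℝ) ≤ w.length := by exact_mod_cast hK
  nlinarith [succ_mul_lapse w.length, lapse_pos w.length]

lemma chainEnd_le_of_honest {k : ℕ} (hv : IsValue θ w (honest k) 0 1 v)
    (hw : w.length = 64 ^ k) {j : ℕ} (hj : j ≤ k + 1) :
    v (chainEnd k j) (.reading (.ret (.up 0)), 0) ≤ (j + 1) * lapse w.length := by
  have hchain := hv.chain_le hw.ge (fun _ => chainEnd_eq_add) (fun _ => honest_isBlock)
    (honest_chain.2 (.inr rfl)) j hj
  have hcycle := hv.cycle_le le_rfl (.up 0) (chainEnd k j) 0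
  simp only [entryPos] at hcycle
  linarith

lemma succ_succ_mul_lapse_le {n k : ℕ} (hn : n = 64 ^ k) : (k + 1 + 1) * lapse n ≤ 1 / 64 := by
  have hk : (k : ℝ) + 1 ≤ n := by
    exact_mod_cast hn ▸ Nat.succ_le_of_lt (Nat.lt_pow_self (by norm_num))
  nlinarith [succ_mul_lapse n, lapse_pos n]

lemma ret_up_le_of_honest {k : ℕ} (hv : IsValue θ w (honest k) 0 1 v) (hw : w.length = 64 ^ k) :
    v 0 (.reading (.ret (.up 0)), 0) ≤ 1 / 64 := by
  have hchain := hv.chainEnd_le_of_honest hw (Nat.le_refl (k + 1))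
  rw [chainEnd_succ_self] at hchain
  push_cast at hchain
  exact hchain.trans (succ_succ_mul_lapse_le hw)

lemma ret_whole_le_of_honest {k : ℕ} (hv : IsValue θ w (honest k) 0 1 v)
    (hw : w.length = 64 ^ k) : v 0 (.reading (.ret .whole), 0) ≤ 1 / 64 := by
  have hblock := honest_isBlock (le_refl k)
  rw [chainEnd_succ_self, ← hw] at hblock
  have hscan : v 0 (.communicating .whole, 1) = v w.length (.reading (.ret (.up 0)), 0) :=
    (hv.whole_isScan hblock.1).eq_of_isFirstMark (by simpa using hblock.2)
  have hchain := hv.chainEnd_le_of_honest hw k.le_succ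
  rw [chainEnd_eq_add le_rfl, chainEnd_succ_self, zero_add, ← hw] at hchain
  have hcycle := hv.cycle_le le_rfl .whole 0 0
  simp only [entryPos] at hcycle
  linarith [succ_succ_mul_lapse_le hw]

lemma completeness (hv : IsValue (countBias I) w (honest k) 0 1 v)
    (hw : w.length = 64 ^ (k : ℕ)) (hk : k ∈ I) : v 0 (.reading (.look 0), 0) ≤ 23 / 50 := by
  have hlength : 2 ≤ w.length := by
    rw [hw]
    exact le_trans (by norm_num) (Nat.le_self_pow k.pos.ne' 64)
  have hlap := hv.ret_lap_le_of_honest hw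
  have hwhole := hv.ret_whole_le_of_honest hw
  have hup := hv.ret_up_le_of_honest hw
  have hcnt := hv.ret_cnt_le le_rfl hw (hw ▸ honest_isFirstMark_both k) (fun _ => rfl)
    (absurd hk)
  rw [hv.init_eq hlength]
  linarith [hlap false, hlap true]

end Completeness

end IsValue

section Verifies

open TwoPFAVerifier

/-- The prover that presents the correct certificate. -/
noncomputable def honestProver (θ : unitInterval) : (verifier θ).Prover :=
  fun w l => honest (Nat.log 64 w.length) (l.length - 1)

lemma certificate_honestProver (θ : unitInterval) (k : ℕ+) :
    certificate (honestProver θ) (upower64Word k) = honest k := by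
  funext t
  simp [certificate, honestProver, upower64Word, Nat.log_pow]

lemma one_sub_ofReal_le {p q : ℝ≥0∞} {ε : ℝ} (hpq : p + q = 1) (hq : q.toReal ≤ ε) :
    1 - ENNReal.ofReal ε ≤ p := by
  have hq_top : q ≠ ∞ := ne_top_of_le_ne_top ENNReal.one_ne_top (hpq ▸ le_add_self)
  rw [tsub_le_iff_right, ← hpq]
  gcongr
  rw [← ENNReal.ofReal_toReal hq_top]
  exact ENNReal.ofReal_le_ofReal hq

lemma verifies (I : Set ℕ+) :
    (verifier (countBias I)).Verifies (UPOWER64 I) (ENNReal.ofReal (23 / 50)) := by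
  have htotal (P : (verifier (countBias I)).Prover) (w : List Unit) :=
    (verifier (countBias I)).acceptProb_add_rejectProb P w
      (ne_top_of_le_ne_top ENNReal.ofReal_ne_top (expectedTime_le (quarter_le_countBias I) P))
  refine ⟨⟨honestProver _, ?_⟩, fun w hw P => ?_⟩
  · rintro _ ⟨k, hk, rfl⟩
    refine one_sub_ofReal_le (htotal _ _) ?_
    have hv := isValue_rejectProb (honestProver (countBias I)) (w := upower64Word k)
    rw [certificate_honestProver] at hv
    rw [rejectProb_eq_haltProb]
    exact hv.completeness List.length_replicate hk
  · refine one_sub_ofReal_le ((add_comm _ _).trans (htotal P w)) ?_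
    rw [acceptProb_eq_haltProb]
    exact (isValue_acceptProb P).soundness hw

end Verifies

end PowerVerifier

lemma verifiableInQuadraticTime_UPOWER64 (I : Set ℕ+) :
    VerifiableInQuadraticTime (UPOWER64 I) := by
  refine ⟨PowerVerifier.verifier (PowerVerifier.countBias I),
    ⟨_, ?_, PowerVerifier.verifies I⟩,
    PowerVerifier.quadraticExpectedTime (PowerVerifier.quarter_le_countBias I)⟩
  rw [ENNReal.ofReal_lt_iff_lt_toReal (by norm_num) (by simp)]
  norm_num

lemma upower64Word_injective : Function.Injective upower64Word := fun k l h =>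
  PNat.coe_injective <| Nat.pow_right_injective (by norm_num : 2 ≤ 64) <| by
    simpa [upower64Word] using congrArg List.length h

lemma UPOWER64_injective : Function.Injective UPOWER64 := by
  have hmem (I : Set ℕ+) (k : ℕ+) : upower64Word k ∈ UPOWER64 I ↔ k ∈ I :=
    ⟨fun ⟨l, hl, h⟩ => upower64Word_injective h ▸ hl, fun hk => ⟨k, hk, rfl⟩⟩
  intro I J h
  ext k
  rw [← hmem I, ← hmem J, h]

lemma not_countable_range_UPOWER64 : ¬(Set.range UPOWER64).Countable := by
  have : Uncountable (Set ℕ+) := Cardinal.aleph0_lt_mk_iff.1 <| by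
    rw [Cardinal.mk_set, Cardinal.mk_eq_aleph0]
    exact Cardinal.cantor _
  exact fun h => Set.not_countable_univ (by simpa using h.preimage UPOWER64_injective)

theorem theorem10 :
    (∀ I : Set ℕ+, VerifiableInQuadraticTime (UPOWER64 I)) ∧
    ¬ {L : Language Unit | VerifiableInQuadraticTime L}.Countable := by
  refine ⟨verifiableInQuadraticTime_UPOWER64, fun h => not_countable_range_UPOWER64 (h.mono ?_)⟩
  rintro _ ⟨I, rfl⟩
  exact verifiableInQuadraticTime_UPOWER64 I
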